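/- For $\alpha\in(-1,1)$ and an integer $m\ge 0$ let $p_m(\cdot;\alpha)$ be the best uniform approximation on $[-1,1]$ to $f(x)=|x-\alpha|$ by real polynomials of degree at most $m$, and let $E_m(\alpha)=\max_{x\in[-1,1]}\bigl||x-\alpha|-p_m(x;\alpha)\bigr|$. The alternation set $\mathcal A_m(\alpha)$ is the set of all points belonging to some sequence $-1\le z_1<\dots<z_N\le 1$ with $N\ge m+2$ and $|z_i-\alpha|-p_m(z_i;\alpha)=\epsilon(-1)^iE_m(\alpha)$ for $i=1,\dots,N$ and some $\epsilon\in\{1,-1\}$. A V-shape of $E_m$ with tip $b$ is an interval $[a,c]\subset(-1,1)$ with $a<b<c$ such that $E_m$ is affine and strictly decreasing on $[a,b]$ and affine and strictly increasing on $[b,c]$; the points of $[a,c]$ are said to be part of it. Fix an integer $n\ge 2$ and for $\alpha\in(-1,1)$ let $$g_\alpha(x)=\frac{p_n(x;\alpha)-|x-\alpha|}{E_n(\alpha)},\qquad x\in\mathbb R .$$ (i) Let $\alpha\in(-1,1)$ be such that $\{-1,1\}\subset\mathcal A_n(\alpha)$, and suppose that $\alpha$ is neither the tip of a V-shape of $E_{n-1}$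 nor part of a V-shape of $E_n$. Then there exists $w\in\mathbb R\setminus[-1,1]$ with $g_\alpha'(w)=0$. (ii) Let $I\subset(-1,1)$ be an interval such that for every $\alpha\in I$ there is a point $w(\alpha)\in\mathbb R\setminus[-1,1]$ with $g_\alpha'(w(\alpha))=0$. Then $\alpha\mapsto w(\alpha)$ is strictly increasing on $I$. -/

import Mathlib

open Set

noncomputable section

/-- The checkmark function `x ↦ |x - α|` as an element of `C([-1,1], ℝ)`. -/
def checkmark (α : ℝ) : C(Icc (-1 : ℝ) 1, ℝ) :=
  ⟨fun x => |(x : ℝ) - α|, by fun_prop⟩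

/-- The uniform norm on `[-1,1]` of `|x - α| - q(x)`. -/
def approxError (α : ℝ) (q : Polynomial ℝ) : ℝ :=
  ‖checkmark α - q.toContinuousMapOn (Icc (-1 : ℝ) 1)‖

/-- `p` is a best uniform approximation on `[-1,1]`, among real polynomials of degree at most `n`,
to the checkmark function with corner `α`. -/
def IsMinimax (n : ℕ) (α : ℝ) (p : Polynomial ℝ) : Prop :=
  p.natDegree ≤ n ∧ ∀ q : Polynomial ℝ, q.natDegree ≤ n → approxError α p ≤ approxError α q

theorem exists_isMinimax (n : ℕ) (α : ℝ) : ∃ p, IsMinimax n α p := by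
  let L : Polynomial ℝ →ₗ[ℝ] C(Icc (-1 : ℝ) 1, ℝ) :=
    (Polynomial.toContinuousMapOnAlgHom (Icc (-1 : ℝ) 1)).toLinearMap
  let S : Submodule ℝ C(Icc (-1 : ℝ) 1, ℝ) := (Polynomial.degreeLT ℝ (n + 1)).map L
  have : FiniteDimensional ℝ (Polynomial.degreeLT ℝ (n + 1)) :=
    LinearEquiv.finiteDimensional (Polynomial.degreeLTEquiv ℝ (n + 1)).symm
  have : FiniteDimensional ℝ S := inferInstance
  have : ProperSpace S := FiniteDimensional.proper ℝ S
  have hmem : ∀ q : Polynomial ℝ, q ∈ Polynomial.degreeLT ℝ (n + 1) ↔ q.natDegree ≤ n := by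
    intro q
    rw [Polynomial.mem_degreeLT, Polynomial.degree_lt_iff_coeff_zero,
      Polynomial.natDegree_le_iff_coeff_eq_zero]
    exact Iff.rfl
  have hcont : Continuous fun s : S => ‖checkmark α - (s : C(Icc (-1 : ℝ) 1, ℝ))‖ := by fun_prop
  have hlim : Filter.Tendsto (fun s : S => ‖checkmark α - (s : C(Icc (-1 : ℝ) 1, ℝ))‖)
      (Filter.cocompact S) Filter.atTop := by
    have h1 : Filter.Tendsto (fun s : S => ‖s‖ - ‖checkmark α‖)
        (Filter.cocompact S) Filter.atTop :=
      Filter.tendsto_atTop_add_const_right _ _ (tendsto_norm_cocompact_atTop (E := S))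
    refine Filter.tendsto_atTop_mono (fun s => ?_) h1
    rw [norm_sub_rev]
    exact norm_sub_norm_le (s : C(Icc (-1 : ℝ) 1, ℝ)) (checkmark α)
  obtain ⟨s, hs⟩ := hcont.exists_forall_le hlim
  obtain ⟨p, hp, hps⟩ := Submodule.mem_map.1 s.2
  refine ⟨p, (hmem p).1 hp, fun q hq => ?_⟩
  have h := hs ⟨L q, Submodule.mem_map_of_mem ((hmem q).2 hq)⟩
  rw [← hps] at h
  exact h

/-- The minimax polynomial `p_n(·; α)`. -/
def minimaxPoly (n : ℕ) (α : ℝ) : Polynomial ℝ :=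
  Classical.choose (exists_isMinimax n α)

/-- The minimax error `E_n(α)`. -/
def minimaxError (n : ℕ) (α : ℝ) : ℝ :=
  approxError α (minimaxPoly n α)

/-- The alternation set: all points of `[-1,1]` that occur in an increasing sequence of at least
`n + 2` points of `[-1,1]` at which the error of the minimax polynomial attains the values
`± E_n(α)` with alternating signs. -/
def alternationSet (n : ℕ) (α : ℝ) : Set ℝ :=
  {z | ∃ N : ℕ, n + 2 ≤ N ∧ ∃ s : Fin N → ℝ, StrictMono s ∧ (∀ i, s i ∈ Icc (-1 : ℝ) 1) ∧
    (∃ ε : ℝ, (ε = 1 ∨ ε = -1) ∧ ∀ i : Fin N,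
      |s i - α| - (minimaxPoly n α).eval (s i) = ε * (-1) ^ (i : ℕ) * minimaxError n α) ∧
    z ∈ Set.range s}

/-- The normalized error `g_α`, as a function on the whole real line. -/
def normalizedError (n : ℕ) (α x : ℝ) : ℝ :=
  ((minimaxPoly n α).eval x - |x - α|) / minimaxError n α

/-- The graph of `E_n` has a V-shape over `[a,c] ⊆ (-1,1)` with tip `b ∈ (a,c)`: `E_n` is
decreasing and linear on `[a,b]`, and increasing and linear on `[b,c]` (which makes it continuous
on `[a,c]`). A V-shape is not required to be maximal; a smaller one has the same tip. -/
def IsVShape (n : ℕ) (a b c : ℝ) : Prop :=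
  -1 < a ∧ a < b ∧ b < c ∧ c < 1 ∧
    (∃ m < 0, ∀ x ∈ Icc a b, minimaxError n x = minimaxError n b + m * (x - b)) ∧
    (∃ m > 0, ∀ x ∈ Icc b c, minimaxError n x = minimaxError n b + m * (x - b))

/-- `α` is the tip of a V-shape of `E_n`. -/
def IsVShapeTip (n : ℕ) (α : ℝ) : Prop :=
  ∃ a c, IsVShape n a α c

/-- `α` is part of a V-shape of `E_n`, endpoints included. -/
def InVShape (n : ℕ) (α : ℝ) : Prop :=
  ∃ a b c, IsVShape n a b c ∧ α ∈ Icc a c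

/-- `w` is a critical point of the normalized error `g_α` outside `[-1,1]`. -/
def IsOutsideCritical (n : ℕ) (α w : ℝ) : Prop :=
  w ∉ Icc (-1 : ℝ) 1 ∧ HasDerivAt (normalizedError n α) 0 w

end

namespace Checkmark

open Polynomial

/-! Part (i) rests on cutting the interval. An error curve of degree at most `m` that equioscillates
at `m + 3` points has one point to spare: cutting the interval at the right or at the left leaves `m
+ 2` points, so the same polynomial, rescaled to `[-1,1]`, is still optimal. The rescaled error is
linear in the rescaled corner, increasing for one cut and decreasing for the other, which gives a
V-shape (`isVShape_of_equiOsc`). Under the hypotheses of (i) the alternations therefore have exactly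
`n + 2` points, and those through `-1` and through `1` have the same sign. The coefficient of `x ^
n` is nonzero, since otherwise `n + 2 = (n - 1) + 3` points would make `α` a tip for `n - 1`. The
sign of this coefficient makes the error turn back beyond one of the end points. Without a critical
point there it would run monotonically through the whole band and reach one more alternation point;
cutting the prolonged interval back to `[-1,1]` puts `α` at the end of a V-shape
(`exists_critical_or_inVShape`).

For part (ii), a critical point outside `[-1,1]` exhausts Rolle's count for `p''`. This forces `-1`,
`1` and the corner into the alternation, the corner as `z j`, and leaves no other inner critical
points (`exists_config_of_outer_critical`). If `α < β` share the index `j` and have outer critical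
points `v`, `w` beyond `1` with `w ≤ v`, the difference of the normalized errors alternates weakly
on each side of the corners. Two applications of the mean value theorem, with `w` as an additional
point, give its second derivative `n` weakly alternating values; having degree at most `n - 2` it
vanishes, and this contradicts `α < β` (`outer_critical_lt`).

The index and the side of the outer critical point are locally constant on `I`: minimax polynomials
depend continuously on the corner (`exists_lipschitz_bound`), the signs of the error determine the
index (`Config.index_eq`), and the top coefficient then determines the side (`exists_config`).
Reflection `x ↦ -x` reduces the left side to the right one. -/

/-! ### Weakly alternating values of polynomials -/

theorem strictMonoOn_Iic_of_lt_succ {z : ℕ → ℝ} {m : ℕ} (h : ∀ i < m, z i < z (i + 1)) :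
    StrictMonoOn z (Iic m) := by
  intro i hi j hj hij
  simp only [mem_Iic] at hi hj
  induction j with
  | zero => omega
  | succ j ih =>
    rcases Nat.lt_succ_iff_lt_or_eq.1 hij with hlt | rfl
    · exact (ih hlt (by omega)).trans (h j (by omega))
    · exact h i (by omega)

/-- The top coefficient of a polynomial as a combination of alternating values, with positive
weights. -/
theorem exists_pos_weights {r : ℕ} {z : ℕ → ℝ} (hz : StrictMonoOn z (Iic r)) :
    ∃ c : ℕ → ℝ, (∀ i ≤ r, 0 < c i) ∧ ∀ q : ℝ[X], q.natDegree ≤ r →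
      (-1) ^ r * q.coeff r = ∑ i ∈ Finset.range (r + 1), c i * ((-1) ^ i * q.eval (z i)) := by
  -- Lagrange's formula for the top coefficient; exactly `r - i` factors of the product are
  -- negative.
  refine ⟨fun i => (-1) ^ (r + i) / ∏ j ∈ (Finset.range (r + 1)).erase i, (z i - z j), ?_, ?_⟩
  · intro i hi
    have hsgn : ∏ j ∈ (Finset.range (r + 1)).erase i, (if i < j then (-1 : ℝ) else 1)
        = (-1) ^ (r - i) := by
      rw [Finset.prod_ite, Finset.prod_const, Finset.prod_const_one, mul_one]
      congr 1
      have : ((Finset.range (r + 1)).erase i).filter (fun j => i < j) = Finset.Ioc i r := by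
        ext j; simp only [Finset.mem_filter, Finset.mem_erase, Finset.mem_range, Finset.mem_Ioc]
        omega
      rw [this, Nat.card_Ioc]
    have hpos : 0 < ∏ j ∈ (Finset.range (r + 1)).erase i,
        ((if i < j then (-1 : ℝ) else 1) * (z i - z j)) := by
      refine Finset.prod_pos fun j hj => ?_
      simp only [Finset.mem_erase, Finset.mem_range] at hj
      split_ifs with hij
      · have := hz (mem_Iic.2 hi) (mem_Iic.2 (by omega : j ≤ r)) hij
        linarith
      · have := hz (mem_Iic.2 (by omega : j ≤ r)) (mem_Iic.2 hi) (by omega)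
        linarith
    rw [Finset.prod_mul_distrib, hsgn] at hpos
    have h2 : (-1 : ℝ) ^ (r + i) = (-1) ^ (r - i) := by
      have : r + i = (r - i) + 2 * i := by omega
      rw [this, pow_add, pow_mul]; simp
    dsimp only
    rw [h2]
    rcases neg_one_pow_eq_or ℝ (r - i) with h | h <;> rw [h] at hpos ⊢
    · rw [one_mul] at hpos; exact div_pos one_pos hpos
    · exact div_pos_of_neg_of_neg (by norm_num) (by linarith)
  · intro q hq
    have hinj : Set.InjOn z (Finset.range (r + 1) : Finset ℕ) := by
      refine hz.injOn.mono fun i hi => ?_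
      simp only [Finset.coe_range, mem_Iio] at hi
      exact mem_Iic.2 (by omega)
    have := Lagrange.coeff_eq_sum (P := q) hinj (by
      rw [Finset.card_range]
      exact (degree_le_of_natDegree_le hq).trans_lt (by exact_mod_cast r.lt_succ_self))
    rw [Finset.card_range, Nat.add_sub_cancel] at this
    rw [this, Finset.mul_sum]
    refine Finset.sum_congr rfl fun i _ => ?_
    have h1 : (-1 : ℝ) ^ i * (-1) ^ i = 1 := by rw [← mul_pow]; simp
    dsimp only
    rw [pow_add]
    linear_combination (-(-1) ^ r * eval (z i) q /
      ∏ j ∈ (Finset.range (r + 1)).erase i, (z i - z j)) * h1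

theorem eq_zero_of_eval_eq_zero {r : ℕ} {q : ℝ[X]} (hq : q.natDegree ≤ r) {z : ℕ → ℝ}
    (hz : StrictMonoOn z (Iic r)) (h : ∀ i ≤ r, q.eval (z i) = 0) : q = 0 := by
  refine Polynomial.eq_zero_of_natDegree_lt_card_of_eval_eq_zero' q
    ((Finset.range (r + 1)).image z) ?_ ?_
  · intro x hx
    obtain ⟨i, hi, rfl⟩ := Finset.mem_image.1 hx
    exact h i (by simpa [Nat.lt_succ_iff] using hi)
  · rw [Finset.card_image_of_injOn, Finset.card_range]
    · omega
    · refine hz.injOn.mono fun i hi => ?_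
      simp only [Finset.coe_range, mem_Iio] at hi
      exact mem_Iic.2 (by omega)

/-- The top coefficient is a positively weighted sum of terms of one sign, so all of them vanish
with it. -/
theorem eval_eq_zero_of_coeff_eq_zero {r : ℕ} {q : ℝ[X]} (hq : q.natDegree ≤ r) {z : ℕ → ℝ}
    (hz : StrictMonoOn z (Iic r)) {σ : ℝ} (hσ : σ ≠ 0)
    (h : ∀ i ≤ r, 0 ≤ σ * ((-1) ^ i * q.eval (z i))) (h0 : q.coeff r = 0) :
    ∀ i ≤ r, q.eval (z i) = 0 := by
  obtain ⟨c, hc, hsum⟩ := exists_pos_weights hz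
  have h1 := hsum q hq
  have h2 : ∑ i ∈ Finset.range (r + 1), c i * (σ * ((-1) ^ i * q.eval (z i))) = 0 := by
    calc _ = σ * ∑ i ∈ Finset.range (r + 1), c i * ((-1) ^ i * q.eval (z i)) := by
          rw [Finset.mul_sum]; exact Finset.sum_congr rfl fun i _ => by ring
      _ = 0 := by rw [← h1, h0]; ring
  rw [Finset.sum_eq_zero_iff_of_nonneg] at h2
  · intro i hi
    have := h2 i (Finset.mem_range.2 (by omega))
    have hci := (hc i hi).ne'
    have hp : (-1 : ℝ) ^ i ≠ 0 := by simp
    simpa [hci, hσ, hp] using this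
  · intro i hi
    have hi' : i ≤ r := by simpa [Nat.lt_succ_iff] using hi
    exact mul_nonneg (hc i hi').le (h i hi')

/-- A polynomial of degree at most `r` with weakly alternating values at `r + 1` points has a
top coefficient of the corresponding sign. -/
theorem coeff_pos_of_weak_alternation {r : ℕ} {q : ℝ[X]} (hq : q.natDegree ≤ r) (hq0 : q ≠ 0)
    {z : ℕ → ℝ} (hz : StrictMonoOn z (Iic r)) {σ : ℝ} (hσ : σ ≠ 0)
    (h : ∀ i ≤ r, 0 ≤ σ * ((-1) ^ i * q.eval (z i))) : 0 < σ * ((-1) ^ r * q.coeff r) := by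
  obtain ⟨c, hc, hsum⟩ := exists_pos_weights hz
  have h1 : σ * ((-1) ^ r * q.coeff r)
      = ∑ i ∈ Finset.range (r + 1), c i * (σ * ((-1) ^ i * q.eval (z i))) := by
    rw [hsum q hq, Finset.mul_sum]; exact Finset.sum_congr rfl fun i _ => by ring
  have h2 : 0 ≤ σ * ((-1) ^ r * q.coeff r) := by
    rw [h1]
    refine Finset.sum_nonneg fun i hi => ?_
    have hi' : i ≤ r := by simpa [Nat.lt_succ_iff] using hi
    exact mul_nonneg (hc i hi').le (h i hi')
  refine lt_of_le_of_ne h2 fun h3 => hq0 ?_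
  have h4 : q.coeff r = 0 := by
    have hp : (-1 : ℝ) ^ r ≠ 0 := by simp
    simpa [hσ, hp] using h3.symm
  exact eq_zero_of_eval_eq_zero hq hz (eval_eq_zero_of_coeff_eq_zero hq hz hσ h h4)

/-- A polynomial of degree at most `r` with weakly alternating values at `r + 2` points is zero. -/
theorem eq_zero_of_weak_alternation {r : ℕ} {q : ℝ[X]} (hq : q.natDegree ≤ r) {z : ℕ → ℝ}
    (hz : StrictMonoOn z (Iic (r + 1))) {σ : ℝ} (hσ : σ ≠ 0)
    (h : ∀ i ≤ r + 1, 0 ≤ σ * ((-1) ^ i * q.eval (z i))) : q = 0 := by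
  by_contra h0
  -- With the degree bound relaxed to `r + 1`, the coefficient whose sign is claimed is zero.
  have := coeff_pos_of_weak_alternation (hq.trans r.le_succ) h0 hz hσ h
  rw [Polynomial.coeff_eq_zero_of_natDegree_lt (by omega)] at this
  simp at this

/-! ### The approximation error, optimality by alternation, reflection -/

theorem abs_error_le (α : ℝ) (q : ℝ[X]) {x : ℝ} (hx : x ∈ Icc (-1 : ℝ) 1) :
    |(|x - α| - q.eval x)| ≤ approxError α q :=
  ContinuousMap.norm_coe_le_norm (checkmark α - q.toContinuousMapOn (Icc (-1 : ℝ) 1)) ⟨x, hx⟩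

theorem approxError_nonneg (α : ℝ) (q : ℝ[X]) : 0 ≤ approxError α q := norm_nonneg _

theorem approxError_le {α : ℝ} {q : ℝ[X]} {E : ℝ}
    (h : ∀ x ∈ Icc (-1 : ℝ) 1, |(|x - α| - q.eval x)| ≤ E) : approxError α q ≤ E := by
  have h0 : 0 ≤ E := (abs_nonneg _).trans (h 0 (by norm_num))
  exact (ContinuousMap.norm_le _ h0).2 fun x => h x x.2

theorem approxError_lt {α : ℝ} {q : ℝ[X]} {E : ℝ}
    (h : ∀ x ∈ Icc (-1 : ℝ) 1, |(|x - α| - q.eval x)| < E) : approxError α q < E := by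
  have h0 : 0 < E := (abs_nonneg _).trans_lt (h 0 (by norm_num))
  exact (ContinuousMap.norm_lt_iff _ h0).2 fun x => h x x.2

theorem isMinimax_minimaxPoly (n : ℕ) (α : ℝ) : IsMinimax n α (minimaxPoly n α) :=
  Classical.choose_spec (exists_isMinimax n α)

theorem approxError_eq_minimaxError {n : ℕ} {α : ℝ} {p : ℝ[X]} (hp : IsMinimax n α p) :
    approxError α p = minimaxError n α :=
  le_antisymm (hp.2 _ (isMinimax_minimaxPoly n α).1) ((isMinimax_minimaxPoly n α).2 _ hp.1)

theorem neg_one_pow_mul_self (i : ℕ) : (-1 : ℝ) ^ i * (-1) ^ i = 1 := by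
  rw [← mul_pow]; simp

theorem sq_eq_one_of_sign {ε : ℝ} (hε : ε = 1 ∨ ε = -1) : ε * ε = 1 := by
  rcases hε with rfl | rfl <;> norm_num

/-- An approximant whose error alternates at `m + 2` points realizes the minimax error. -/
theorem minimaxError_eq_of_alternation {m : ℕ} {α E ε : ℝ} {q : ℝ[X]} (hq : q.natDegree ≤ m)
    (hb : ∀ x ∈ Icc (-1 : ℝ) 1, |(|x - α| - q.eval x)| ≤ E) {z : ℕ → ℝ}
    (hz : StrictMonoOn z (Iic (m + 1))) (hzm : ∀ i ≤ m + 1, z i ∈ Icc (-1 : ℝ) 1)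
    (hε : ε = 1 ∨ ε = -1) (he : ∀ i ≤ m + 1, |z i - α| - q.eval (z i) = ε * (-1) ^ i * E) :
    minimaxError m α = E := by
  have hP := isMinimax_minimaxPoly m α
  have hle : minimaxError m α ≤ E := (hP.2 q hq).trans (approxError_le hb)
  by_contra hne
  have hlt := lt_of_le_of_ne hle hne
  have hεε := sq_eq_one_of_sign hε
  -- A strictly better approximant has to correct `q` at every `z i` in the direction of the error
  -- there.
  have key : ∀ i ≤ m + 1, 0 < ε * ((-1) ^ i * (minimaxPoly m α - q).eval (z i)) := by
    intro i hi
    have h1 := abs_error_le α (minimaxPoly m α) (hzm i hi)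
    have h2 := he i hi
    have h3 : approxError α (minimaxPoly m α) < E := hlt
    have h4 : |ε * (-1) ^ i * (|z i - α| - (minimaxPoly m α).eval (z i))| < E := by
      rw [abs_mul]
      have : |ε * (-1) ^ i| = 1 := by rcases hε with rfl | rfl <;> simp
      rw [this, one_mul]; exact h1.trans_lt h3
    have h5 := (abs_lt.1 h4).2
    have h6 : ε * (-1) ^ i * (|z i - α| - q.eval (z i)) = E := by
      rw [h2]
      linear_combination (E * ((-1) ^ i * (-1) ^ i)) * hεε + E * neg_one_pow_mul_self i
    rw [eval_sub]
    linarith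
  have h0 := eq_zero_of_weak_alternation (r := m)
    ((natDegree_sub_le _ _).trans (max_le hP.1 hq)) hz
    (σ := ε) (by rcases hε with rfl | rfl <;> norm_num) fun i hi => (key i hi).le
  have := key 0 (by omega)
  rw [h0] at this
  simp at this

theorem approxError_neg (α : ℝ) (q : ℝ[X]) : approxError (-α) (q.comp (-X)) = approxError α q := by
  refine le_antisymm (approxError_le fun x hx => ?_) (approxError_le fun x hx => ?_)
  · have := abs_error_le α q (x := -x) ⟨by linarith [hx.2], by linarith [hx.1]⟩
    have h1 : |x - -α| = |-x - α| := by rw [← abs_neg]; ring_nf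
    rw [h1]
    simpa using this
  · have := abs_error_le (-α) (q.comp (-X)) (x := -x) ⟨by linarith [hx.2], by linarith [hx.1]⟩
    have h1 : |-x - -α| = |x - α| := by rw [← abs_neg]; ring_nf
    rw [h1] at this
    simpa using this

theorem natDegree_comp_neg_X (q : ℝ[X]) : (q.comp (-X)).natDegree = q.natDegree := by
  rw [natDegree_comp]; simp

theorem comp_neg_X_comp_neg_X (q : ℝ[X]) : (q.comp (-X)).comp (-X) = q := by
  rw [comp_assoc]; simp

theorem isMinimax_comp_neg_X {n : ℕ} {α : ℝ} {p : ℝ[X]} (hp : IsMinimax n α p) :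
    IsMinimax n (-α) (p.comp (-X)) := by
  refine ⟨(natDegree_comp_neg_X p).trans_le hp.1, fun q hq => ?_⟩
  have := hp.2 (q.comp (-X)) ((natDegree_comp_neg_X q).trans_le hq)
  rw [approxError_neg]
  rwa [← approxError_neg α (q.comp (-X)), comp_neg_X_comp_neg_X] at this

theorem minimaxError_neg (n : ℕ) (α : ℝ) : minimaxError n (-α) = minimaxError n α := by
  have h := isMinimax_minimaxPoly n α
  rw [← approxError_eq_minimaxError h, ← approxError_eq_minimaxError (isMinimax_comp_neg_X h),
    approxError_neg]

/-! ### Equioscillation and V-shapes -/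

section EquiOscillation

/-- The error of `q` is bounded by `E` on `[A, B]` and takes the values `± E` with alternating
signs at the points `z 0 < ... < z m` of `[A, B]`. -/
structure EquiOsc (m : ℕ) (α E : ℝ) (q : ℝ[X]) (A B : ℝ) (z : ℕ → ℝ) (ε : ℝ) : Prop where
  bound : ∀ x ∈ Icc A B, |(|x - α| - q.eval x)| ≤ E
  mono : StrictMonoOn z (Iic m)
  mem : ∀ i ≤ m, z i ∈ Icc A B
  sign : ε = 1 ∨ ε = -1
  alt : ∀ i ≤ m, |z i - α| - q.eval (z i) = ε * (-1) ^ i * E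

variable {m : ℕ} {α E A B ε : ℝ} {q : ℝ[X]} {z : ℕ → ℝ}

theorem EquiOsc.of_le {k : ℕ} (h : EquiOsc m α E q A B z ε) (hk : k ≤ m) :
    EquiOsc k α E q A B z ε :=
  ⟨h.bound, h.mono.mono (Iic_subset_Iic.2 hk), fun i hi => h.mem i (hi.trans hk), h.sign,
    fun i hi => h.alt i (hi.trans hk)⟩

theorem EquiOsc.tail (h : EquiOsc (m + 1) α E q A B z ε) :
    EquiOsc m α E q A B (fun i => z (i + 1)) (-ε) := by
  refine ⟨h.bound, fun i hi j hj hij => h.mono (mem_Iic.2 ?_) (mem_Iic.2 ?_) (by omega),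
    fun i hi => h.mem _ (by omega), ?_, fun i hi => ?_⟩
  · have := mem_Iic.1 hi; omega
  · have := mem_Iic.1 hj; omega
  · rcases h.sign with rfl | rfl <;> simp
  · rw [h.alt (i + 1) (by omega), pow_succ]; ring

theorem EquiOsc.sub_interval {A' B' : ℝ} (h : EquiOsc m α E q A B z ε) (hA : A ≤ A') (hB : B' ≤ B)
    (hA' : A' ≤ z 0) (hB' : z m ≤ B') : EquiOsc m α E q A' B' z ε := by
  refine ⟨fun x hx => h.bound x ⟨hA.trans hx.1, hx.2.trans hB⟩, h.mono, fun i hi => ⟨?_, ?_⟩,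
    h.sign, h.alt⟩
  · exact hA'.trans (h.mono.monotoneOn (mem_Iic.2 m.zero_le) (mem_Iic.2 hi) i.zero_le)
  · exact (h.mono.monotoneOn (mem_Iic.2 hi) (mem_Iic.2 le_rfl) hi).trans hB'

theorem EquiOsc.reflect (h : EquiOsc m α E q A B z ε) :
    EquiOsc m (-α) E (q.comp (-X)) (-B) (-A) (fun i => -z (m - i)) (ε * (-1) ^ m) := by
  have habs : ∀ x, |-x - -α| = |x - α| := fun x => by rw [← abs_neg]; ring_nf
  refine ⟨fun x hx => ?_, fun i hi j hj hij => ?_, fun i hi => ?_, ?_, fun i hi => ?_⟩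
  · have := h.bound (-x) ⟨by linarith [hx.2], by linarith [hx.1]⟩
    rw [← habs, neg_neg] at this
    simpa using this
  · simp only [mem_Iic] at hi hj
    exact neg_lt_neg (h.mono (mem_Iic.2 (by omega)) (mem_Iic.2 (by omega)) (by omega))
  · have := h.mem (m - i) (by omega)
    exact ⟨by linarith [this.2], by linarith [this.1]⟩
  · rcases h.sign with rfl | rfl <;> rcases neg_one_pow_eq_or ℝ m with h | h <;> simp [h]
  · have := h.alt (m - i) (by omega)
    have h2 : (-1 : ℝ) ^ m * (-1) ^ i = (-1) ^ (m - i) := by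
      have : m + i = m - i + 2 * i := by omega
      rw [← pow_add, this, pow_add, pow_mul]; simp
    rw [habs, mul_assoc ε, h2]
    simpa using this

theorem minimaxError_eq_of_equiOsc (hq : q.natDegree ≤ m)
    (h : EquiOsc (m + 1) α E q (-1) 1 z ε) : minimaxError m α = E :=
  minimaxError_eq_of_alternation hq h.bound h.mono h.mem h.sign h.alt

/-- Transport of an alternation on `[A, B]` to `[-1, 1]`. -/
theorem minimaxError_of_equiOsc_interval (hq : q.natDegree ≤ m)
    (h : EquiOsc (m + 1) α E q A B z ε) (hAB : A < B) :
    minimaxError m ((2 * α - A - B) / (B - A)) = 2 * E / (B - A) := by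
  have hpos : 0 < B - A := by linarith
  set c : ℝ := 2 / (B - A) with hc
  have hc0 : 0 < c := by positivity
  have hcB : c * (B - A) = 2 := by rw [hc]; field_simp
  set Q : ℝ[X] := C c * q.comp (C ((B - A) / 2) * X + C ((A + B) / 2)) with hQ
  have hα : (2 * α - A - B) / (B - A) = c * (α - (A + B) / 2) := by rw [hc]; field_simp; ring
  have hE : 2 * E / (B - A) = c * E := by rw [hc]; field_simp
  have hval : ∀ y, |c * (y - (A + B) / 2) - c * (α - (A + B) / 2)|
      - Q.eval (c * (y - (A + B) / 2)) = c * (|y - α| - q.eval y) := by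
    intro y
    have h1 : (B - A) / 2 * (c * (y - (A + B) / 2)) + (A + B) / 2 = y := by
      linear_combination ((y - (A + B) / 2) / 2) * hcB
    simp only [hQ, eval_mul, eval_C, eval_comp, eval_add, eval_X, h1]
    rw [← mul_sub, abs_mul, abs_of_pos hc0]; ring_nf
  rw [hα, hE]
  refine minimaxError_eq_of_equiOsc (q := Q) (z := fun i => c * (z i - (A + B) / 2)) (ε := ε) ?_
    ⟨fun x hx => ?_, fun i hi j hj hij => ?_, fun i hi => ?_, h.sign, fun i hi => ?_⟩
  · refine (natDegree_C_mul_le _ _).trans (natDegree_comp_le.trans ?_)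
    refine (Nat.mul_le_mul hq (natDegree_linear_le)).trans (by simp)
  · have h1 : x = c * (((B - A) / 2 * x + (A + B) / 2) - (A + B) / 2) := by
      linear_combination (-x / 2) * hcB
    rw [h1, hval, abs_mul, abs_of_pos hc0]
    refine mul_le_mul_of_nonneg_left (h.bound _ ⟨?_, ?_⟩) hc0.le <;> nlinarith [hx.1, hx.2]
  · exact mul_lt_mul_of_pos_left (by linarith [h.mono hi hj hij]) hc0
  · have := h.mem i hi
    constructor <;> nlinarith [this.1, this.2]
  · rw [hval, h.alt i hi]; ring

/-- An alternation of length `m + 3` on `[A, B]` produces a V-shape of `E_m` by cutting the interval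
at either end. -/
theorem isVShape_of_equiOsc {s t : ℝ} (hq : q.natDegree ≤ m) (hE : 0 < E)
    (h : EquiOsc (m + 2) α E q A B z ε) (hAs : A < s) (hs : s < α) (hs1 : s ≤ z 1)
    (ht : α < t) (htB : t < B) (ht1 : z (m + 1) ≤ t) :
    IsVShape m ((2 * α - s - B) / (B - s)) ((2 * α - A - B) / (B - A))
      ((2 * α - A - t) / (t - A)) := by
  -- Only `z (m + 2)` is given up when `B` moves to some `t' ∈ [t, B]`. The value `t'` below is the
  -- one that rescales the corner to `x`, and `2 * E / (t' - A)` is then linear in `x`.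
  have hright : ∀ x ∈ Icc ((2 * α - A - B) / (B - A)) ((2 * α - A - t) / (t - A)),
      minimaxError m x = E / (α - A) * (x + 1) := by
    intro x hx
    have hx1 : 2 * (α - A) ≤ (x + 1) * (B - A) := by
      have := (div_le_iff₀ (by linarith : 0 < B - A)).1 hx.1
      linarith
    have hx2 : (x + 1) * (t - A) ≤ 2 * (α - A) := by
      have := (le_div_iff₀ (by linarith : 0 < t - A)).1 hx.2
      linarith
    have hx0 : 0 < x + 1 := by
      by_contra hcon
      nlinarith
    set t' := A + 2 * (α - A) / (x + 1) with ht'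
    have e1 : (t' - A) * (x + 1) = 2 * (α - A) := by rw [ht']; field_simp; ring
    have htt : t ≤ t' := by
      by_contra hcon
      nlinarith
    have htB' : t' ≤ B := by
      by_contra hcon
      nlinarith
    have hA' : A ≤ z 0 := (h.mem 0 (by omega)).1
    have := minimaxError_of_equiOsc_interval hq
      ((h.of_le (by omega : m + 1 ≤ m + 2)).sub_interval le_rfl htB' hA' (ht1.trans htt))
      (by linarith)
    have e2 : (2 * α - A - t') / (t' - A) = x := by
      rw [div_eq_iff (by linarith)]; linarith
    have hne : t' - A ≠ 0 := by linarith
    have hne2 : α - A ≠ 0 := by linarith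
    rw [e2] at this
    rw [this]
    field_simp
    linarith
  -- The mirror image: `A` moves to `s'`, and `z 0` is given up.
  have hleft : ∀ x ∈ Icc ((2 * α - s - B) / (B - s)) ((2 * α - A - B) / (B - A)),
      minimaxError m x = E / (B - α) * (1 - x) := by
    intro x hx
    have hx1 : (1 - x) * (B - s) ≤ 2 * (B - α) := by
      have := (div_le_iff₀ (by linarith : 0 < B - s)).1 hx.1
      linarith
    have hx2 : 2 * (B - α) ≤ (1 - x) * (B - A) := by
      have := (le_div_iff₀ (by linarith : 0 < B - A)).1 hx.2
      linarith
    have hx0 : 0 < 1 - x := by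
      by_contra hcon
      nlinarith
    set s' := B - 2 * (B - α) / (1 - x) with hs'
    have e1 : (B - s') * (1 - x) = 2 * (B - α) := by rw [hs']; field_simp; ring
    have hss : s' ≤ s := by
      by_contra hcon
      nlinarith
    have hsA : A ≤ s' := by
      by_contra hcon
      nlinarith
    have hB' : z (m + 2) ≤ B := (h.mem _ le_rfl).2
    have := minimaxError_of_equiOsc_interval hq
      (h.tail.sub_interval hsA le_rfl (hss.trans hs1) hB') (by linarith)
    have e2 : (2 * α - s' - B) / (B - s') = x := by
      rw [div_eq_iff (by linarith)]; linarith
    have hne : B - s' ≠ 0 := by linarith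
    have hne2 : B - α ≠ 0 := by linarith
    rw [e2] at this
    rw [this]
    field_simp
    linarith
  have hab : (2 * α - s - B) / (B - s) < (2 * α - A - B) / (B - A) := by
    rw [div_lt_div_iff₀ (by linarith) (by linarith)]; nlinarith
  have hbc : (2 * α - A - B) / (B - A) < (2 * α - A - t) / (t - A) := by
    rw [div_lt_div_iff₀ (by linarith) (by linarith)]; nlinarith
  refine ⟨?_, hab, hbc, ?_, ⟨-(E / (B - α)), ?_, fun x hx => ?_⟩, ⟨E / (α - A), ?_, fun x hx => ?_⟩⟩
  · rw [lt_div_iff₀ (by linarith)]; linarith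
  · rw [div_lt_iff₀ (by linarith)]; linarith
  · exact neg_neg_of_pos (div_pos hE (by linarith))
  · rw [hleft x hx, hleft _ (right_mem_Icc.2 hab.le)]; ring
  · exact div_pos hE (by linarith)
  · rw [hright x hx, hright _ (left_mem_Icc.2 hbc.le)]; ring

/-- On `[-1,1]` the rescaling is trivial, so the tip is the corner itself. -/
theorem isVShapeTip_of_equiOsc (hq : q.natDegree ≤ m) (hE : 0 < E) (hα : α ∈ Ioo (-1 : ℝ) 1)
    (h : EquiOsc (m + 2) α E q (-1) 1 z ε) : IsVShapeTip m α := by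
  have h1 : -1 < z 1 :=
    (h.mem 0 (by omega)).1.trans_lt (h.mono (mem_Iic.2 (by omega)) (mem_Iic.2 (by omega)) one_pos)
  have h2 : z (m + 1) < 1 :=
    (h.mono (mem_Iic.2 (by omega)) (mem_Iic.2 le_rfl) (by omega)).trans_le (h.mem (m + 2) le_rfl).2
  obtain ⟨s, hs, hs'⟩ := exists_between (lt_min hα.1 h1)
  obtain ⟨t, ht, ht'⟩ := exists_between (max_lt hα.2 h2)
  have := isVShape_of_equiOsc hq hE h hs (hs'.trans_le (min_le_left _ _))
    (hs'.trans_le (min_le_right _ _)).le ((le_max_left _ _).trans_lt ht) ht'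
    ((le_max_right _ _).trans_lt ht).le
  have e : (2 * α - -1 - 1) / (1 - -1) = α := by ring
  rw [e] at this
  exact ⟨_, _, this⟩

theorem inVShape_neg {n : ℕ} {α : ℝ} (h : InVShape n (-α)) : InVShape n α := by
  obtain ⟨a, b, c, ⟨h1, h2, h3, h4, ⟨μ, hμ, hl⟩, ⟨ν, hν, hr⟩⟩, hα⟩ := h
  refine ⟨-c, -b, -a, ⟨by linarith, by linarith, by linarith, by linarith,
    ⟨-ν, by linarith, fun x hx => ?_⟩, ⟨-μ, by linarith, fun x hx => ?_⟩⟩,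
    ⟨by linarith [hα.2], by linarith [hα.1]⟩⟩
  · have := hr (-x) ⟨by linarith [hx.2], by linarith [hx.1]⟩
    rw [minimaxError_neg] at this
    rw [this, minimaxError_neg]; ring
  · have := hl (-x) ⟨by linarith [hx.2], by linarith [hx.1]⟩
    rw [minimaxError_neg] at this
    rw [this, minimaxError_neg]; ring

theorem EquiOsc.append {B' u : ℝ} (h : EquiOsc m α E q A B z ε) (hB : B ≤ B') (hu : z m < u)
    (huB : u ≤ B') (hb : ∀ x ∈ Icc A B', |(|x - α| - q.eval x)| ≤ E)
    (he : |u - α| - q.eval u = ε * (-1) ^ (m + 1) * E) :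
    EquiOsc (m + 1) α E q A B' (fun i => if i ≤ m then z i else u) ε := by
  refine ⟨hb, strictMonoOn_Iic_of_lt_succ fun i hi => ?_, fun i hi => ?_, h.sign, fun i hi => ?_⟩
  · have hi' : i ≤ m := by omega
    simp only [hi', if_true]
    split_ifs with h1
    · exact h.mono (mem_Iic.2 hi') (mem_Iic.2 h1) i.lt_succ_self
    · obtain rfl : i = m := by omega
      exact hu
  · split_ifs with h1
    · exact ⟨(h.mem i h1).1, (h.mem i h1).2.trans hB⟩
    · exact ⟨(h.mem m le_rfl).1.trans hu.le, huB⟩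
  · split_ifs with h1
    · exact h.alt i h1
    · obtain rfl : i = m + 1 := by omega
      exact he

theorem eval_pos_of_forall_ne_zero {r : ℝ[X]} {s : Set ℝ} (hs : s.OrdConnected)
    (h : ∀ x ∈ s, r.eval x ≠ 0) {a b : ℝ} (ha : a ∈ s) (hb : b ∈ s) (hr : 0 < r.eval a) :
    0 < r.eval b := by
  by_contra hcon
  obtain ⟨x, hx, hx0⟩ := hs.isPreconnected.intermediate_value hb ha
    (r.continuous.continuousOn) (show (0 : ℝ) ∈ Icc (r.eval b) (r.eval a) from
      ⟨not_lt.1 hcon, hr.le⟩)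
  exact h x hx hx0

/-- If the error curve to the right of `1` eventually turns back, then either it has a critical
point there, or prolonging the interval to the right shows that `α` is part of a V-shape. -/
theorem exists_critical_or_inVShape {n : ℕ} (hn : 2 ≤ n) (hq : q.natDegree ≤ n) (hE : 0 < E)
    (hα : α ∈ Ioo (-1 : ℝ) 1) (h : EquiOsc (n + 1) α E q (-1) 1 z ε) (hz : z (n + 1) = 1)
    (hc : 0 < ε * (-1) ^ (n + 1) * q.coeff n) :
    (∃ w > 1, q.derivative.eval w = 1) ∨ InVShape n α := by
  by_cases hw : ∃ w > 1, q.derivative.eval w = 1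
  · exact Or.inl hw
  push Not at hw
  right
  -- The sign of the error at `1`: after multiplication by it, the right branch `ψ` starts at `E`
  -- and tends to `-∞`.
  set σ : ℝ := ε * (-1) ^ (n + 1) with hσ
  have hσσ : σ * σ = 1 := by
    rw [hσ]
    linear_combination ((-1) ^ (n + 1) * (-1) ^ (n + 1)) * sq_eq_one_of_sign h.sign
      + neg_one_pow_mul_self (n + 1)
  have hσabs : |σ| = 1 := by
    have : |σ| * |σ| = 1 := by rw [← abs_mul, hσσ, abs_one]
    nlinarith [abs_nonneg σ]
  have hσ0 : σ ≠ 0 := fun h0 => by simp [h0] at hσσ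
  set ψ : ℝ[X] := C σ * (X - C α - q) with hψ
  have hψe : ∀ x, ψ.eval x = σ * (x - α - q.eval x) := fun x => by simp [hψ]
  have hψd : ∀ x, ψ.derivative.eval x = σ * (1 - q.derivative.eval x) := fun x => by simp [hψ]
  have hψn : ψ.coeff n = -(σ * q.coeff n) := by
    simp only [hψ, coeff_C_mul, coeff_sub, coeff_X, coeff_C]
    rw [if_neg (by omega), if_neg (by omega)]; ring
  have hdeg : ψ.natDegree = n := by
    refine natDegree_eq_of_le_of_coeff_ne_zero ?_ ?_
    · refine (natDegree_C_mul_le _ _).trans ((natDegree_sub_le _ _).trans (max_le ?_ hq))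
      rw [natDegree_X_sub_C]; omega
    · rw [hψn]; exact (neg_neg_of_pos hc).ne
  have hlead : ψ.leadingCoeff ≤ 0 := by
    rw [leadingCoeff, hdeg, hψn]; linarith
  have htend := ψ.tendsto_atBot_of_leadingCoeff_nonpos
    (natDegree_pos_iff_degree_pos.1 (by omega)) hlead
  have hψ1 : ψ.eval 1 = E := by
    have := h.alt (n + 1) le_rfl
    rw [hz, abs_of_pos (by linarith [hα.2])] at this
    rw [hψe, this, ← hσ, ← mul_assoc, hσσ, one_mul]
  have hne : ∀ x ∈ Ioi (1 : ℝ), ψ.derivative.eval x ≠ 0 := by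
    intro x hx h0
    rw [hψd] at h0
    rcases mul_eq_zero.1 h0 with h1 | h1
    · exact hσ0 h1
    · exact hw x hx (by linarith)
  -- A nonvanishing derivative has constant sign, and a positive one contradicts the limit `-∞`.
  have hneg : ∀ x ∈ Ioi (1 : ℝ), ψ.derivative.eval x < 0 := by
    intro x hx
    refine lt_of_le_of_ne (not_lt.1 fun hpos => ?_) (hne x hx)
    have hmono : StrictMonoOn (fun x => ψ.eval x) (Ici 1) := by
      refine strictMonoOn_of_deriv_pos (convex_Ici 1) ψ.continuous.continuousOn fun y hy => ?_
      rw [interior_Ici] at hy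
      rw [Polynomial.deriv]
      exact eval_pos_of_forall_ne_zero ordConnected_Ioi hne hx hy hpos
    obtain ⟨y, hy, hy1⟩ := ((htend.eventually (Filter.eventually_lt_atBot E)).and
      (Filter.eventually_gt_atTop 1)).exists
    have := hmono (mem_Ici.2 le_rfl) (mem_Ici.2 hy1.le) hy1
    dsimp only at this
    linarith
  have hanti : StrictAntiOn (fun x => ψ.eval x) (Ici 1) := by
    refine strictAntiOn_of_deriv_neg (convex_Ici 1) ψ.continuous.continuousOn fun y hy => ?_
    rw [interior_Ici] at hy
    rw [Polynomial.deriv]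
    exact hneg y hy
  obtain ⟨u, hu1, huE⟩ : ∃ u > 1, ψ.eval u = -E := by
    obtain ⟨y, hy, hy1⟩ := ((htend.eventually (Filter.eventually_lt_atBot (-E))).and
      (Filter.eventually_gt_atTop 1)).exists
    obtain ⟨u, hu, hu'⟩ := intermediate_value_Icc' hy1.le ψ.continuous.continuousOn
      (show -E ∈ Icc (ψ.eval y) (ψ.eval 1) from ⟨hy.le, by linarith⟩)
    refine ⟨u, lt_of_le_of_ne hu.1 ?_, hu'⟩
    rintro rfl
    exact absurd (hψ1.symm.trans hu') (by linarith)
  have happ := h.append (B' := u) (u := u) hu1.le (hz.trans_lt hu1) le_rfl (fun x hx => ?_) ?_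
  · have h1 : -1 < z 1 := (h.mem 0 (by omega)).1.trans_lt
      (h.mono (mem_Iic.2 (by omega)) (mem_Iic.2 (by omega)) one_pos)
    obtain ⟨s, hs, hs'⟩ := exists_between (lt_min hα.1 h1)
    -- The prolonged interval `[-1, u]` carries `n + 3` points. The cut at `t = 1` restores
    -- `[-1,1]`, so `α` is the right end of this V-shape.
    have hV := isVShape_of_equiOsc (s := s) (t := 1) hq hE happ hs
      (hs'.trans_le (min_le_left _ _))
      (by simpa using (hs'.trans_le (min_le_right _ _)).le) hα.2 hu1 (by simp [hz])
    have e : (2 * α - -1 - 1) / (1 - -1) = α := by ring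
    rw [e] at hV
    exact ⟨_, _, _, hV, (hV.2.1.trans hV.2.2.1).le, le_rfl⟩
  · rcases le_total x 1 with hx1 | hx1
    · exact h.bound x ⟨hx.1, hx1⟩
    · have e : |(|x - α| - q.eval x)| = |ψ.eval x| := by
        rw [abs_of_pos (by linarith [hα.2] : 0 < x - α), hψe, abs_mul, hσabs, one_mul]
      rw [e, abs_le, ← huE]
      constructor
      · exact hanti.antitoneOn (mem_Ici.2 hx1) (mem_Ici.2 hu1.le) hx.2
      · rw [← hψ1]
        exact hanti.antitoneOn (mem_Ici.2 le_rfl) (mem_Ici.2 hx1) hx1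
  · rw [abs_of_pos (by linarith [hα.2] : 0 < u - α)]
    have h1 := hψe u
    rw [huE] at h1
    have h2 : ε * (-1) ^ (n + 1 + 1) * E = -(σ * E) := by rw [hσ, pow_succ _ (n + 1)]; ring
    rw [h2]
    linear_combination (-σ) * h1 - (u - α - q.eval u) * hσσ

end EquiOscillation

/-! ### Critical points of the normalized error; part (i) -/

/-- With zero error, the polynomial would equal both branches of the checkmark. -/
theorem minimaxError_pos (n : ℕ) {α : ℝ} (hα : α ∈ Ioo (-1 : ℝ) 1) : 0 < minimaxError n α := by
  refine lt_of_le_of_ne (approxError_nonneg _ _) fun h0 => ?_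
  set p := minimaxPoly n α
  have hz : ∀ x ∈ Icc (-1 : ℝ) 1, p.eval x = |x - α| := by
    intro x hx
    have := abs_error_le α p hx
    rw [show approxError α p = 0 from h0.symm] at this
    have := abs_eq_zero.1 (le_antisymm this (abs_nonneg _))
    linarith
  have h1 : p = C α - X := by
    refine eq_of_infinite_eval_eq _ _ ((Icc_infinite hα.1).mono fun x hx => ?_)
    simp only [mem_ofPred_eq, eval_sub, eval_C, eval_X]
    rw [hz x ⟨hx.1, hx.2.trans hα.2.le⟩, abs_of_nonpos (by linarith [hx.2])]; ring
  have h2 : p = X - C α := by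
    refine eq_of_infinite_eval_eq _ _ ((Icc_infinite hα.2).mono fun x hx => ?_)
    simp only [mem_ofPred_eq, eval_sub, eval_C, eval_X]
    rw [hz x ⟨hα.1.le.trans hx.1, hx.2⟩, abs_of_nonneg (by linarith [hx.1])]
  have h3 := congrArg (fun r => r.eval (α + 1)) (h1.symm.trans h2)
  simp at h3
  linarith

theorem hasDerivAt_abs_sub_of_gt {α w : ℝ} (h : α < w) : HasDerivAt (fun x => |x - α|) 1 w := by
  have := (hasDerivAt_abs_pos (by linarith : 0 < w - α)).comp w ((hasDerivAt_id w).sub_const α)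
  simpa [Function.comp_def] using this

theorem hasDerivAt_abs_sub_of_lt {α w : ℝ} (h : w < α) : HasDerivAt (fun x => |x - α|) (-1) w := by
  have := (hasDerivAt_abs_neg (by linarith : w - α < 0)).comp w ((hasDerivAt_id w).sub_const α)
  simpa [Function.comp_def] using this

theorem hasDerivAt_normalizedError_iff_of_gt {n : ℕ} {α w : ℝ} (hα : α ∈ Ioo (-1 : ℝ) 1)
    (hw : 1 < w) :
    HasDerivAt (normalizedError n α) 0 w ↔ (minimaxPoly n α).derivative.eval w = 1 := by
  have h := (((minimaxPoly n α).hasDerivAt w).sub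
    (hasDerivAt_abs_sub_of_gt (hα.2.trans hw))).div_const (minimaxError n α)
  have hE := (minimaxError_pos n hα).ne'
  refine ⟨fun h0 => ?_, fun h1 => ?_⟩
  · have := h.unique h0
    rw [div_eq_zero_iff] at this
    have := this.resolve_right hE
    linarith
  · rw [h1, sub_self, zero_div] at h
    exact h

theorem hasDerivAt_normalizedError_iff_of_lt {n : ℕ} {α w : ℝ} (hα : α ∈ Ioo (-1 : ℝ) 1)
    (hw : w < -1) :
    HasDerivAt (normalizedError n α) 0 w ↔ (minimaxPoly n α).derivative.eval w = -1 := by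
  have h := (((minimaxPoly n α).hasDerivAt w).sub
    (hasDerivAt_abs_sub_of_lt (hw.trans hα.1))).div_const (minimaxError n α)
  have hE := (minimaxError_pos n hα).ne'
  refine ⟨fun h0 => ?_, fun h1 => ?_⟩
  · have := h.unique h0
    rw [div_eq_zero_iff] at this
    have := this.resolve_right hE
    linarith
  · rw [h1, sub_self, zero_div] at h
    exact h

theorem exists_equiOsc_of_mem_alternationSet {n : ℕ} {α x : ℝ} (hx : x ∈ alternationSet n α) :
    ∃ M z ε, n + 1 ≤ M ∧ EquiOsc M α (minimaxError n α) (minimaxPoly n α) (-1) 1 z ε ∧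
      ∃ i ≤ M, z i = x := by
  obtain ⟨N, hN, s, hs, hmem, ⟨ε, hε, halt⟩, ⟨i₀, hi₀⟩⟩ := hx
  have hz : ∀ i (hi : i < N), (if h : i < N then s ⟨i, h⟩ else 0) = s ⟨i, hi⟩ :=
    fun i hi => by simp [hi]
  refine ⟨N - 1, fun i => if h : i < N then s ⟨i, h⟩ else 0, ε, by omega,
    ⟨fun x hx => abs_error_le α _ hx, fun i hi j hj hij => ?_, fun i hi => ?_, hε, fun i hi => ?_⟩,
    i₀, by have := i₀.2; omega, ?_⟩
  · simp only [mem_Iic] at hi hj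
    rw [hz i (by omega), hz j (by omega)]
    exact hs (Fin.mk_lt_mk.2 hij)
  · rw [hz i (by omega)]; exact hmem _
  · rw [hz i (by omega)]; exact halt _
  · exact (hz i₀ i₀.2).trans hi₀

theorem coeff_comp_neg_X (q : ℝ[X]) (n : ℕ) : (q.comp (-X)).coeff n = (-1) ^ n * q.coeff n := by
  have : (-X : ℝ[X]) = C (-1) * X := by simp
  rw [this, comp_C_mul_X_coeff, mul_comm]

theorem eval_derivative_comp_neg_X (q : ℝ[X]) (x : ℝ) :
    (q.comp (-X)).derivative.eval x = -q.derivative.eval (-x) := by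
  simp [derivative_comp]

theorem exists_isOutsideCritical {n : ℕ} (hn : 2 ≤ n) {α : ℝ} (hα : α ∈ Ioo (-1 : ℝ) 1)
    (hA : {-1, 1} ⊆ alternationSet n α) (htip : ¬ IsVShapeTip (n - 1) α) (hV : ¬ InVShape n α) :
    ∃ w, IsOutsideCritical n α w := by
  have hE := minimaxError_pos n hα
  set p := minimaxPoly n α with hp
  set E := minimaxError n α with hEdef
  have hdeg : p.natDegree ≤ n := (isMinimax_minimaxPoly n α).1
  have hlong : ∀ z ε, ¬ EquiOsc (n + 2) α E p (-1) 1 z ε := by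
    intro z ε h
    obtain ⟨a, c, h'⟩ := isVShapeTip_of_equiOsc hdeg hE hα h
    exact hV ⟨a, α, c, h', h'.2.1.le, h'.2.2.1.le⟩
  obtain ⟨M, z, ε, hM, h, i, hi, hzi⟩ := exists_equiOsc_of_mem_alternationSet (hA (by simp))
    (x := -1)
  obtain ⟨M', z', ε', hM', h', i', hi', hzi'⟩ := exists_equiOsc_of_mem_alternationSet (hA (by simp))
    (x := 1)
  obtain rfl : M = n + 1 := by
    by_contra hne
    exact hlong _ _ (h.of_le (by omega))
  obtain rfl : M' = n + 1 := by
    by_contra hne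
    exact hlong _ _ (h'.of_le (by omega))
  have hz0 : z 0 = -1 := by
    refine le_antisymm ?_ (h.mem 0 (by omega)).1
    rw [← hzi]
    exact h.mono.monotoneOn (mem_Iic.2 (by omega)) (mem_Iic.2 hi) i.zero_le
  have hz1 : z' (n + 1) = 1 := by
    refine le_antisymm (h'.mem _ le_rfl).2 ?_
    rw [← hzi']
    exact h'.mono.monotoneOn (mem_Iic.2 hi') (mem_Iic.2 le_rfl) hi'
  -- With opposite signs, the point `1` could be appended to the sequence `z`, which would be too
  -- long.
  obtain rfl : ε' = ε := by
    by_contra hne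
    have hneg : ε' = -ε := by
      rcases h.sign with rfl | rfl <;> rcases h'.sign with rfl | rfl <;> simp_all
    have h1 := h'.alt (n + 1) le_rfl
    rw [hz1] at h1
    have h2 := h.alt (n + 1) le_rfl
    have h3 : z (n + 1) ≠ 1 := by
      intro h3
      rw [h3, h1, hneg] at h2
      have h4 : ε * (-1) ^ (n + 1) * E = 0 := by linarith
      have h5 : ε ≠ 0 := by rcases h.sign with rfl | rfl <;> norm_num
      simp [h5, hE.ne'] at h4
    refine hlong _ _ (h.append (B' := 1) (u := 1) le_rfl
      (lt_of_le_of_ne (h.mem _ le_rfl).2 h3) le_rfl h.bound ?_)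
    rw [h1, hneg]; ring
  rcases lt_trichotomy (ε' * (-1) ^ (n + 1) * p.coeff n) 0 with hc | hc | hc
  -- The error turns back to the left of `-1`; reflection changes the sign of the quantity in `hc`.
  · have hr := h.reflect
    rw [neg_neg] at hr
    rcases exists_critical_or_inVShape hn ((natDegree_comp_neg_X p).trans_le hdeg) hE
      (show -α ∈ Ioo (-1 : ℝ) 1 from ⟨by linarith [hα.2], by linarith [hα.1]⟩) hr (by simp [hz0])
      (by
        rw [coeff_comp_neg_X, mul_assoc ε', neg_one_pow_mul_self, mul_one]
        have e : ε' * ((-1) ^ n * p.coeff n) = -(ε' * (-1) ^ (n + 1) * p.coeff n) := by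
          rw [pow_succ]; ring
        rw [e]; linarith) with ⟨w, hw, hw'⟩ | hV'
    · refine ⟨-w, fun hmem => by linarith [hmem.1], ?_⟩
      rw [hasDerivAt_normalizedError_iff_of_lt hα (by linarith), ← hp]
      rw [eval_derivative_comp_neg_X] at hw'
      linarith
    · exact absurd (inVShape_neg hV') hV
  -- The degree drops to `n - 1`, and `n + 2` points are one more than optimality needs there.
  · exfalso
    have h5 : ε' ≠ 0 := by rcases h.sign with rfl | rfl <;> norm_num
    have hc0 : p.coeff n = 0 := by simpa [h5] using hc
    obtain ⟨k, rfl⟩ : ∃ k, n = k + 1 := ⟨n - 1, by omega⟩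
    refine htip (isVShapeTip_of_equiOsc (q := p) ?_ hE hα h)
    rw [Nat.add_sub_cancel]
    refine natDegree_le_iff_coeff_eq_zero.2 fun N hN => ?_
    rcases Nat.lt_or_ge (k + 1) N with h1 | h1
    · exact coeff_eq_zero_of_natDegree_lt (by omega)
    · obtain rfl : N = k + 1 := by omega
      exact hc0
  · rcases exists_critical_or_inVShape hn hdeg hE hα h' hz1 hc with ⟨w, hw, hw'⟩ | hV'
    · exact ⟨w, fun hmem => by linarith [hmem.2],
        (hasDerivAt_normalizedError_iff_of_gt hα hw).2 hw'⟩
    · exact absurd hV' hV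

/-! ### Chebyshev's alternation theorem -/

theorem eq_neg_of_sign_of_ne {a b : ℝ} (ha : a = 1 ∨ a = -1) (hb : b = 1 ∨ b = -1) (hab : a ≠ b) :
    a = -b := by
  rcases ha with rfl | rfl <;> rcases hb with rfl | rfl <;>
    first | exact absurd rfl hab | norm_num

theorem sign_mul_neg_one_pow {ε : ℝ} (hε : ε = 1 ∨ ε = -1) (m : ℕ) :
    ε * (-1) ^ m = 1 ∨ ε * (-1) ^ m = -1 := by
  rcases hε with rfl | rfl <;> rcases neg_one_pow_eq_or ℝ m with h | h <;> simp [h]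

/-- A finite set of signed points contains an alternating sequence `z 0 < ... < z m` such that the
signs are those of a polynomial of degree at most `m`. -/
theorem exists_alternating_and_polynomial (S : Finset ℝ) (σ : ℝ → ℝ) (hS : S.Nonempty)
    (hσ : ∀ x ∈ S, σ x = 1 ∨ σ x = -1) :
    ∃ (m : ℕ) (z : ℕ → ℝ) (ε : ℝ) (r : ℝ[X]), StrictMonoOn z (Iic m) ∧ (∀ i ≤ m, z i ∈ S) ∧
      (ε = 1 ∨ ε = -1) ∧ (∀ i ≤ m, σ (z i) = ε * (-1) ^ i) ∧ r.natDegree ≤ m ∧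
      (∀ x ∈ S, 0 < σ x * r.eval x) ∧
      ∀ x, (∀ y ∈ S, y ≤ x) → 0 < ε * (-1) ^ m * r.eval x := by
  induction S using Finset.induction_on_max with
  | empty => simp at hS
  | insert a S hmax ih =>
    rcases S.eq_empty_or_nonempty with rfl | hne
    · have h1 := hσ a (by simp)
      have h2 : 0 < σ a * σ a := by rw [sq_eq_one_of_sign h1]; exact one_pos
      refine ⟨0, fun _ => a, σ a, C (σ a), fun i hi j hj hij => ?_, by simp, h1, by simp,
        by simp, by simpa using h2, fun x _ => by simpa using h2⟩
      simp only [mem_Iic] at hj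
      omega
    obtain ⟨m, z, ε, r, hz, hzS, hε, halt, hr, hpos, hlast⟩ :=
      ih hne fun x hx => hσ x (Finset.mem_insert_of_mem hx)
    have ha := hlast a fun y hy => (hmax y hy).le
    by_cases hτ : σ a = ε * (-1) ^ m
    · refine ⟨m, z, ε, r, hz, fun i hi => Finset.mem_insert_of_mem (hzS i hi), hε, halt, hr,
        fun x hx => ?_, fun x hx => hlast x fun y hy => hx y (Finset.mem_insert_of_mem hy)⟩
      rcases Finset.mem_insert.1 hx with rfl | hx
      · rwa [hτ]
      · exact hpos x hx
    have hτ' : σ a = -(ε * (-1) ^ m) :=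
      eq_neg_of_sign_of_ne (hσ a (by simp)) (sign_mul_neg_one_pow hε m) hτ
    -- At each sign change the polynomial gets a root between the two neighbouring points.
    obtain ⟨t, ht1, ht2⟩ := exists_between (hmax _ (S.max'_mem hne))
    have htS : ∀ y ∈ S, y < t := fun y hy => (S.le_max' y hy).trans_lt ht1
    refine ⟨m + 1, fun i => if i ≤ m then z i else a, ε, r * (C t - X),
      strictMonoOn_Iic_of_lt_succ fun i hi => ?_, fun i hi => ?_, hε, fun i hi => ?_, ?_,
      fun x hx => ?_, fun x hx => ?_⟩
    · have hi' : i ≤ m := by omega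
      simp only [hi', if_true]
      split_ifs with h1
      · exact hz (mem_Iic.2 hi') (mem_Iic.2 h1) i.lt_succ_self
      · exact hmax _ (hzS i hi')
    · dsimp only
      split_ifs with h1
      · exact Finset.mem_insert_of_mem (hzS i h1)
      · exact Finset.mem_insert_self _ _
    · dsimp only
      split_ifs with h1
      · exact halt i h1
      · obtain rfl : i = m + 1 := by omega
        rw [hτ', pow_succ]; ring
    · refine natDegree_mul_le.trans (add_le_add hr ?_)
      exact (natDegree_sub_le _ _).trans (by simp)
    · simp only [eval_mul, eval_sub, eval_C, eval_X]
      rw [← mul_assoc]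
      rcases Finset.mem_insert.1 hx with rfl | hx
      · rw [hτ']
        nlinarith
      · exact mul_pos (hpos x hx) (sub_pos.2 (htS x hx))
    · have hx' := hlast x fun y hy => hx y (Finset.mem_insert_of_mem hy)
      have hxa := hx a (Finset.mem_insert_self _ _)
      simp only [eval_mul, eval_sub, eval_C, eval_X, pow_succ]
      have : 0 < (ε * (-1) ^ m * eval x r) * (x - t) := mul_pos hx' (by linarith)
      linarith

/-- If some polynomial of degree at most `n` has the sign of the error at all extremal points, the
approximant is not optimal. -/
theorem not_isMinimax_of_sign {n : ℕ} {α : ℝ} {p r : ℝ[X]} (hr : r.natDegree ≤ n)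
    (hE : 0 < approxError α p)
    (hpos : ∀ x ∈ Icc (-1 : ℝ) 1, |(|x - α| - p.eval x)| = approxError α p →
      0 < (|x - α| - p.eval x) * r.eval x) : ¬ IsMinimax n α p := by
  intro hp
  set E := approxError α p with hEdef
  set e : ℝ → ℝ := fun x => |x - α| - p.eval x with he
  have hec : Continuous e :=
    (by fun_prop : Continuous fun x => |x - α|).sub p.continuous
  have hbound : ∀ x ∈ Icc (-1 : ℝ) 1, |e x| ≤ E := fun x hx => abs_error_le α p hx
  obtain ⟨M, hM0, hM⟩ : ∃ M > 0, ∀ x ∈ Icc (-1 : ℝ) 1, |r.eval x| ≤ M := by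
    obtain ⟨M, hM⟩ := isCompact_Icc.exists_bound_of_continuousOn (r.continuous.continuousOn
      (s := Icc (-1 : ℝ) 1))
    exact ⟨max M 1, by positivity, fun x hx => (hM x hx).trans (le_max_left _ _)⟩
  -- Where `r` does not have the sign of the error, compactness keeps the error uniformly below `E`;
  -- a small multiple of `r` does no harm there and helps elsewhere.
  obtain ⟨η, hηE, hη⟩ : ∃ η < E, ∀ x ∈ Icc (-1 : ℝ) 1, e x * r.eval x ≤ 0 → |e x| ≤ η := by
    set K : Set ℝ := Icc (-1 : ℝ) 1 ∩ {x | e x * r.eval x ≤ 0} with hK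
    have hKc : IsCompact K := isCompact_Icc.inter_right
      (isClosed_le (hec.mul r.continuous) continuous_const)
    rcases K.eq_empty_or_nonempty with h0 | hne
    · refine ⟨0, hE, fun x hx hx' => ?_⟩
      have : x ∈ K := ⟨hx, hx'⟩
      simp [h0] at this
    · obtain ⟨y, hy, hmax⟩ := hKc.exists_isMaxOn hne hec.abs.continuousOn
      refine ⟨|e y|, lt_of_le_of_ne (hbound y hy.1) fun heq => ?_, fun x hx hx' => hmax ⟨hx, hx'⟩⟩
      exact absurd (hpos y hy.1 heq) (not_lt.2 hy.2)
  obtain ⟨t, ht0, ht⟩ := exists_between (lt_min (div_pos hE hM0) (div_pos (sub_pos.2 hηE) hM0))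
  have ht1 : t * M < E := (lt_div_iff₀ hM0).1 (ht.trans_le (min_le_left _ _))
  have ht2 : t * M < E - η := (lt_div_iff₀ hM0).1 (ht.trans_le (min_le_right _ _))
  have hlt : approxError α (p + C t * r) < E := by
    refine approxError_lt fun x hx => ?_
    have hval : |x - α| - (p + C t * r).eval x = e x - t * r.eval x := by
      simp [he]; ring
    rw [hval]
    have hr1 := hM x hx
    have hr2 : |t * r.eval x| ≤ t * M := by
      rw [abs_mul, abs_of_pos ht0]; exact mul_le_mul_of_nonneg_left hr1 ht0.le
    by_cases hs : e x * r.eval x ≤ 0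
    · have := hη x hx hs
      calc |e x - t * r.eval x| ≤ |e x| + |t * r.eval x| := abs_sub _ _
        _ < E := by linarith
    · have hb := abs_le.1 (hbound x hx)
      have hr3 := abs_le.1 hr2
      rcases pos_and_pos_or_neg_and_neg_of_mul_pos (not_le.1 hs) with ⟨h1, h2⟩ | ⟨h1, h2⟩
      · have := mul_pos ht0 h2
        rw [abs_lt]; constructor <;> linarith
      · have := mul_neg_of_pos_of_neg ht0 h2
        rw [abs_lt]; constructor <;> linarith
  refine absurd (hp.2 (p + C t * r) ?_) (not_le.2 hlt)
  exact (natDegree_add_le _ _).trans (max_le hp.1 ((natDegree_C_mul_le _ _).trans hr))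

/-- The comparison polynomial is the chord `1 - α * x` through the end points of the graph, lowered
by half its height `1 - α ^ 2` above the corner. -/
theorem minimaxError_le_half {n : ℕ} (hn : 1 ≤ n) {α : ℝ} (hα : α ∈ Ioo (-1 : ℝ) 1) :
    minimaxError n α ≤ (1 - α ^ 2) / 2 := by
  refine ((isMinimax_minimaxPoly n α).2 (C ((1 + α ^ 2) / 2) - C α * X) ?_).trans
    (approxError_le fun x hx => ?_)
  · refine (natDegree_sub_le _ _).trans ?_
    simpa using (natDegree_C_mul_le α X).trans (natDegree_X_le.trans hn)
  · obtain ⟨h1, h2⟩ := hx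
    obtain ⟨h3, h4⟩ := hα
    simp only [eval_sub, eval_C, eval_mul, eval_X]
    rcases le_total x α with h | h
    · rw [abs_of_nonpos (by linarith : x - α ≤ 0), abs_le]
      constructor <;> nlinarith
    · rw [abs_of_nonneg (by linarith : 0 ≤ x - α), abs_le]
      constructor <;> nlinarith

/-- If the left branch of the error were constant, the error would differ by `2 * (1 - α)` between
`-1` and `1`. This exceeds `1 - α ^ 2`, which bounds twice the minimax error. -/
theorem left_piece_ne_C {n : ℕ} (hn : 1 ≤ n) {α : ℝ} (hα : α ∈ Ioo (-1 : ℝ) 1) {p : ℝ[X]}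
    (hp : IsMinimax n α p) (s : ℝ) : C α - X - p ≠ C s := by
  intro h
  have hv : ∀ x, α - x - p.eval x = s := fun x => by
    have := congrArg (eval x) h
    simpa using this
  have h1 := abs_error_le α p (x := 1) (by norm_num)
  have h2 := abs_error_le α p (x := -1) (by norm_num)
  rw [approxError_eq_minimaxError hp] at h1 h2
  have hE := minimaxError_le_half hn hα
  rw [abs_of_pos (by linarith [hα.2] : 0 < 1 - α)] at h1
  rw [abs_of_neg (by linarith [hα.1] : -1 - α < 0)] at h2
  have h3 := hv 1
  have h4 := hv (-1)
  nlinarith [abs_le.1 h1, abs_le.1 h2, hα.1, hα.2]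

theorem right_piece_ne_C {n : ℕ} (hn : 1 ≤ n) {α : ℝ} (hα : α ∈ Ioo (-1 : ℝ) 1) {p : ℝ[X]}
    (hp : IsMinimax n α p) (s : ℝ) : X - C α - p ≠ C s := by
  intro h
  refine left_piece_ne_C hn (show -α ∈ Ioo (-1 : ℝ) 1 from ⟨by linarith [hα.2], by linarith [hα.1]⟩)
    (isMinimax_comp_neg_X hp) s ?_
  have := congrArg (fun r => r.comp (-X)) h
  simp only [sub_comp, X_comp, C_comp] at this
  rw [← this, C_neg]
  ring

/-- Neither branch is constant, so each attains `E` and `-E` finitely often. The alternation can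
then be extracted by induction on a finite set. -/
theorem finite_extremal {n : ℕ} (hn : 1 ≤ n) {α : ℝ} (hα : α ∈ Ioo (-1 : ℝ) 1) {p : ℝ[X]}
    (hp : IsMinimax n α p) (E : ℝ) : {x | |(|x - α| - p.eval x)| = E}.Finite := by
  have hroot : ∀ r : ℝ[X], (∀ s, r ≠ C s) → ∀ s, {x | r.eval x = s}.Finite := by
    intro r hr s
    have h0 : r - C s ≠ 0 := sub_ne_zero.2 (hr s)
    refine (finite_setOfPred_isRoot h0).subset fun x hx => ?_
    have hx' : r.eval x = s := hx
    simp [IsRoot, hx']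
  have hL := hroot _ (left_piece_ne_C hn hα hp)
  have hR := hroot _ (right_piece_ne_C hn hα hp)
  refine ((hL E).union ((hL (-E)).union ((hR E).union (hR (-E))))).subset fun x hx => ?_
  have hx' : |(|x - α| - p.eval x)| = E := hx
  simp only [mem_union, mem_ofPred_eq, eval_sub, eval_C, eval_X]
  have hE : 0 ≤ E := hx' ▸ abs_nonneg _
  rcases (abs_eq hE).1 hx' with h1 | h1 <;> rcases le_total x α with h2 | h2
  · rw [abs_of_nonpos (by linarith)] at h1; left; linarith
  · rw [abs_of_nonneg (by linarith)] at h1; right; right; left; linarith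
  · rw [abs_of_nonpos (by linarith)] at h1; right; left; linarith
  · rw [abs_of_nonneg (by linarith)] at h1; right; right; right; linarith

/-- Chebyshev alternation: the error of a minimax polynomial alternates at `n + 2` points. -/
theorem exists_equiOsc_of_isMinimax {n : ℕ} (hn : 1 ≤ n) {α : ℝ} (hα : α ∈ Ioo (-1 : ℝ) 1)
    {p : ℝ[X]} (hp : IsMinimax n α p) :
    ∃ z ε, EquiOsc (n + 1) α (minimaxError n α) p (-1) 1 z ε := by
  have hE := minimaxError_pos n hα
  have hpE := approxError_eq_minimaxError hp
  set E := minimaxError n α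
  have hfin : (Icc (-1 : ℝ) 1 ∩ {x | |(|x - α| - p.eval x)| = E}).Finite :=
    (finite_extremal hn hα hp E).subset inter_subset_right
  set S := hfin.toFinset with hS
  have hmem : ∀ x, x ∈ S ↔ x ∈ Icc (-1 : ℝ) 1 ∧ |(|x - α| - p.eval x)| = E := fun x => by
    rw [hS, Finite.mem_toFinset]; rfl
  by_cases hne : S.Nonempty
  · obtain ⟨m, z, ε, r, hz, hzS, hε, halt, hr, hpos, -⟩ := exists_alternating_and_polynomial S
      (fun x => (|x - α| - p.eval x) / E) hne (fun x hx => by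
        rcases (abs_eq hE.le).1 ((hmem x).1 hx).2 with h | h <;> simp [h, hE.ne'])
    -- Too few sign changes would give a sign polynomial of degree at most `n`, hence an
    -- improvement.
    rcases Nat.lt_or_ge n m with hm | hm
    · refine ⟨z, ε, EquiOsc.of_le (m := m) ⟨fun x hx => hpE ▸ abs_error_le α p hx, hz,
        fun i hi => ((hmem _).1 (hzS i hi)).1, hε, fun i hi => ?_⟩ hm⟩
      have := halt i hi
      rwa [div_eq_iff hE.ne'] at this
    · refine absurd hp (not_isMinimax_of_sign (hr.trans hm) (hpE ▸ hE) fun x hx hx' => ?_)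
      have := hpos x ((hmem x).2 ⟨hx, hx'.trans hpE⟩)
      rw [div_mul_eq_mul_div] at this
      exact (div_pos_iff_of_pos_right hE).1 this
  · refine absurd hp (not_isMinimax_of_sign (r := 0) (by simp) (hpE ▸ hE) fun x hx hx' => ?_)
    exact absurd ⟨x, (hmem x).2 ⟨hx, hx'.trans hpE⟩⟩ hne

/-! ### Counting critical points -/

/-- Rolle's theorem for a finite set of points of a level set. -/
theorem exists_finset_derivative_roots {P : ℝ[X]} {c : ℝ} (S : Finset ℝ)
    (h : ∀ x ∈ S, P.eval x = c) :
    ∃ T : Finset ℝ, S.card ≤ T.card + 1 ∧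
      ∀ t ∈ T, P.derivative.eval t = 0 ∧ (∃ a ∈ S, a < t) ∧ ∃ b ∈ S, t < b := by
  induction S using Finset.induction_on_max with
  | empty => exact ⟨∅, by simp⟩
  | insert a S hmax ih =>
    rcases S.eq_empty_or_nonempty with rfl | hne
    · exact ⟨∅, by simp⟩
    obtain ⟨T, hcard, hT⟩ := ih fun x hx => h x (Finset.mem_insert_of_mem hx)
    have hM := S.max'_mem hne
    obtain ⟨t, ht, ht'⟩ := exists_deriv_eq_zero (f := fun x => P.eval x) (hmax _ hM)
      P.continuous.continuousOn
      ((h _ (Finset.mem_insert_of_mem hM)).trans (h a (Finset.mem_insert_self _ _)).symm)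
    rw [Polynomial.deriv] at ht'
    have htT : t ∉ T := fun hmem => by
      obtain ⟨-, -, b, hb, htb⟩ := hT t hmem
      exact absurd (htb.trans_le (S.le_max' b hb)) (not_lt.2 ht.1.le)
    refine ⟨insert t T, ?_, fun x hx => ?_⟩
    · rw [Finset.card_insert_of_notMem htT,
        Finset.card_insert_of_notMem fun ha => lt_irrefl a (hmax a ha)]
      omega
    · rcases Finset.mem_insert.1 hx with rfl | hx
      · exact ⟨ht', ⟨_, Finset.mem_insert_of_mem hM, ht.1⟩, a, Finset.mem_insert_self _ _, ht.2⟩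
      · obtain ⟨h1, ⟨b, hb, hb'⟩, c, hc, hc'⟩ := hT x hx
        exact ⟨h1, ⟨b, Finset.mem_insert_of_mem hb, hb'⟩, c, Finset.mem_insert_of_mem hc, hc'⟩

theorem card_le_natDegree_of_roots {P : ℝ[X]} (hP : P ≠ 0) (T : Finset ℝ)
    (h : ∀ t ∈ T, P.eval t = 0) : T.card ≤ P.natDegree := by
  by_contra hcon
  exact hP (eq_zero_of_natDegree_lt_card_of_eval_eq_zero' P T h (not_le.1 hcon))

theorem card_level_le {P : ℝ[X]} {c : ℝ} (hP : P.derivative ≠ 0) {S : Finset ℝ}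
    (h : ∀ x ∈ S, P.eval x = c) : S.card ≤ P.derivative.natDegree + 1 := by
  obtain ⟨T, hT, hT'⟩ := exists_finset_derivative_roots S h
  have := card_le_natDegree_of_roots hP T fun t ht => (hT' t ht).1
  omega

/-- Two level sets of a polynomial, one to the left of the other. -/
theorem card_add_card_level_le {P : ℝ[X]} {a b : ℝ} (hP : P.derivative ≠ 0) {S T : Finset ℝ}
    (hS : ∀ x ∈ S, P.eval x = a) (hT : ∀ x ∈ T, P.eval x = b) (hST : ∀ x ∈ S, ∀ y ∈ T, x < y) :
    S.card + T.card ≤ P.derivative.natDegree + 2 := by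
  obtain ⟨S', hS', hS''⟩ := exists_finset_derivative_roots S hS
  obtain ⟨T', hT', hT''⟩ := exists_finset_derivative_roots T hT
  have hdisj : Disjoint S' T' := by
    rw [Finset.disjoint_left]
    intro x hx hx'
    obtain ⟨-, -, u, hu, hu'⟩ := hS'' x hx
    obtain ⟨-, ⟨v, hv, hv'⟩, -⟩ := hT'' x hx'
    linarith [hST u hu v hv]
  have := card_le_natDegree_of_roots hP (S' ∪ T') fun t ht => by
    rcases Finset.mem_union.1 ht with h | h
    · exact (hS'' t h).1
    · exact (hT'' t h).1
  rw [Finset.card_union_of_disjoint hdisj] at this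
  omega

/-- The mean value theorem along a weakly alternating sequence. -/
theorem exists_alternating_derivative {f : ℝ[X]} {a b : ℕ} {d : ℕ → ℝ} {σ : ℝ}
    (hd : ∀ i, a ≤ i → i < b → d i < d (i + 1))
    (hf : ∀ i, a ≤ i → i ≤ b → 0 ≤ σ * ((-1) ^ i * f.eval (d i))) :
    ∃ c : ℕ → ℝ, ∀ i, a ≤ i → i < b →
      d i < c i ∧ c i < d (i + 1) ∧ 0 ≤ -σ * ((-1) ^ i * f.derivative.eval (c i)) := by
  have key : ∀ i, ∃ c, a ≤ i → i < b →
      d i < c ∧ c < d (i + 1) ∧ 0 ≤ -σ * ((-1) ^ i * f.derivative.eval c) := by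
    intro i
    by_cases h : a ≤ i ∧ i < b
    · obtain ⟨c, hc, hc'⟩ := exists_deriv_eq_slope (fun x => f.eval x) (hd i h.1 h.2)
        f.continuous.continuousOn f.differentiable.differentiableOn
      rw [Polynomial.deriv] at hc'
      refine ⟨c, fun _ _ => ⟨hc.1, hc.2, ?_⟩⟩
      have h1 := hf i h.1 h.2.le
      have h2 := hf (i + 1) (by omega) h.2
      have hpos : 0 < d (i + 1) - d i := sub_pos.2 (hd i h.1 h.2)
      rw [pow_succ] at h2
      rw [hc', mul_div_assoc', mul_div_assoc']
      refine div_nonneg ?_ hpos.le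
      linarith
    · exact ⟨0, fun h1 h2 => absurd ⟨h1, h2⟩ h⟩
  choose c hc using key
  exact ⟨c, hc⟩

theorem derivative_eval_of_extremal {α E s x : ℝ} {p : ℝ[X]}
    (hb : ∀ y ∈ Icc (-1 : ℝ) 1, |(|y - α| - p.eval y)| ≤ E) (hx : x ∈ Ioo (-1 : ℝ) 1)
    (hE : |(|x - α| - p.eval x)| = E) (hs : HasDerivAt (fun y => |y - α|) s x) :
    p.derivative.eval x = s := by
  have hd := hs.sub (p.hasDerivAt x)
  have hnhds : Icc (-1 : ℝ) 1 ∈ nhds x := Icc_mem_nhds hx.1 hx.2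
  have hE0 : 0 ≤ E := hE ▸ abs_nonneg _
  have h0 : s - p.derivative.eval x = 0 := by
    rcases (abs_eq hE0).1 hE with h | h
    · refine IsLocalMax.hasDerivAt_eq_zero (f := (fun y => |y - α|) - fun y => p.eval y) ?_ hd
      filter_upwards [hnhds] with y hy
      have := (abs_le.1 (hb y hy)).2
      simp only [Pi.sub_apply]
      linarith
    · refine IsLocalMin.hasDerivAt_eq_zero (f := (fun y => |y - α|) - fun y => p.eval y) ?_ hd
      filter_upwards [hnhds] with y hy
      have := (abs_le.1 (hb y hy)).1
      simp only [Pi.sub_apply]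
      linarith
  linarith

/-- The error cannot have a maximum at the corner. -/
theorem error_corner_ne {α E : ℝ} {p : ℝ[X]} (hα : α ∈ Ioo (-1 : ℝ) 1)
    (hb : ∀ y ∈ Icc (-1 : ℝ) 1, |(|y - α| - p.eval y)| ≤ E) : |α - α| - p.eval α ≠ E := by
  intro hE
  have hkey : ∀ y ∈ Icc (-1 : ℝ) 1, |y - α| ≤ p.eval y - p.eval α := by
    intro y hy
    have := (abs_le.1 (hb y hy)).2
    simp only [sub_self, abs_zero] at hE
    linarith
  -- The difference quotient of `p` at `α` is a polynomial `r`; a maximum at the corner would give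
  -- `r(α) ≥ 1` from the right and `r(α) ≤ -1` from the left.
  obtain ⟨r, hr⟩ := (dvd_iff_isRoot (p := p - C (p.eval α)) (a := α)).2 (by simp [IsRoot])
  have hr' : ∀ y, p.eval y - p.eval α = (y - α) * r.eval y := fun y => by
    have := congrArg (eval y) hr
    simpa using this
  have h1 : 1 ≤ r.eval α := by
    refine ge_of_tendsto (r.continuous.continuousWithinAt (s := Ioi α) (x := α))
      (Filter.eventually_of_mem (Ioo_mem_nhdsGT hα.2) fun y hy => ?_)
    have := hkey y ⟨by linarith [hy.1, hα.1], hy.2.le⟩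
    rw [hr', abs_of_pos (by linarith [hy.1])] at this
    have hpos : 0 < y - α := by linarith [hy.1]
    exact le_of_mul_le_mul_left (by linarith) hpos
  have h2 : r.eval α ≤ -1 := by
    refine le_of_tendsto (r.continuous.continuousWithinAt (s := Iio α) (x := α))
      (Filter.eventually_of_mem (Ioo_mem_nhdsLT hα.1) fun y hy => ?_)
    have := hkey y ⟨hy.1.le, by linarith [hy.2, hα.2]⟩
    rw [hr', abs_of_neg (by linarith [hy.2])] at this
    have hpos : 0 < α - y := by linarith [hy.2]
    refine le_of_mul_le_mul_left (?_ : (α - y) * r.eval y ≤ (α - y) * -1) hpos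
    linarith
  linarith

/-- For affine `p` the error is convex and cannot take the values `-E, E, -E` in this order. Since
`n ≥ 2`, there are four alternation points, which contain this pattern for either sign. -/
theorem derivative_derivative_ne_zero {n : ℕ} (hn : 2 ≤ n) {α E ε : ℝ} {p : ℝ[X]} {z : ℕ → ℝ}
    (hE : 0 < E) (h : EquiOsc (n + 1) α E p (-1) 1 z ε) : p.derivative.derivative ≠ 0 := by
  intro h0
  have hconst := eq_C_of_natDegree_eq_zero (derivative_eq_zero.1 h0)
  set u := p.derivative.coeff 0
  have hconst2 : (p - C u * X).derivative = 0 := by simp [hconst]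
  have hlin := eq_C_of_natDegree_eq_zero (derivative_eq_zero.1 hconst2)
  set v := (p - C u * X).coeff 0
  have hp : ∀ x, p.eval x = u * x + v := fun x => by
    have := congrArg (eval x) hlin
    simp only [eval_sub, eval_mul, eval_C, eval_X] at this
    linarith
  have key : ∀ i, i + 2 ≤ n + 1 → |z i - α| - p.eval (z i) = -E →
      |z (i + 1) - α| - p.eval (z (i + 1)) = E → |z (i + 2) - α| - p.eval (z (i + 2)) = -E →
      False := by
    intro i hi h1 h2 h3
    have hlt1 := h.mono (mem_Iic.2 (by omega : i ≤ n + 1)) (mem_Iic.2 (by omega)) i.lt_succ_self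
    have hlt2 := h.mono (mem_Iic.2 (by omega : i + 1 ≤ n + 1)) (mem_Iic.2 hi) (i + 1).lt_succ_self
    simp only [Nat.succ_eq_add_one] at hlt1 hlt2
    set a := z i
    set y := z (i + 1)
    set c := z (i + 2)
    have habs : (c - a) * |y - α| ≤ (c - y) * |a - α| + (y - a) * |c - α| := by
      have e1 : (c - a) * |y - α| = |(c - y) * (a - α) + (y - a) * (c - α)| := by
        rw [← abs_of_pos (by linarith : 0 < c - a), ← abs_mul]
        ring_nf
      rw [e1]
      refine (abs_add_le _ _).trans ?_
      rw [abs_mul, abs_mul, abs_of_pos (by linarith : 0 < c - y),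
        abs_of_pos (by linarith : 0 < y - a)]
    rw [hp] at h1 h2 h3
    have e1 : |a - α| = u * a + v - E := by linarith
    have e2 : |y - α| = u * y + v + E := by linarith
    have e3 : |c - α| = u * c + v - E := by linarith
    rw [e1, e2, e3] at habs
    nlinarith [mul_pos (by linarith : 0 < c - a) hE]
  have a0 := h.alt 0 (by omega)
  have a1 := h.alt 1 (by omega)
  have a2 := h.alt 2 (by omega)
  have a3 := h.alt 3 (by omega)
  rcases h.sign with rfl | rfl
  · exact key 1 (by omega) (by rw [a1]; ring) (by rw [a2]; ring) (by rw [a3]; ring)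
  · exact key 0 (by omega) (by rw [a0]; ring) (by rw [a1]; ring) (by rw [a2]; ring)

theorem natDegree_derivative_derivative_le {n : ℕ} {p : ℝ[X]} (hp : p.natDegree ≤ n) :
    p.derivative.derivative.natDegree ≤ n - 2 := by
  have h1 := natDegree_derivative_le p
  have h2 := natDegree_derivative_le p.derivative
  omega

/-! ### Configurations with an outer critical point -/

/-- The alternation `z 0 < ... < z (n + 1)` contains both end points, and the corner as `z j`, and
there are no more critical points on either side of the corner than the alternation forces. -/
structure Config (n : ℕ) (α E : ℝ) (p : ℝ[X]) (j : ℕ) (z : ℕ → ℝ) : Prop where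
  pos : 0 < j
  le : j ≤ n
  osc : EquiOsc (n + 1) α E p (-1) 1 z (-(-1) ^ j)
  zero : z 0 = -1
  last : z (n + 1) = 1
  corner : z j = α
  left : ∀ S : Finset ℝ, (∀ x ∈ S, -1 < x ∧ x < α ∧ p.derivative.eval x = -1) → S.card < j
  right : ∀ S : Finset ℝ, (∀ x ∈ S, α < x ∧ x < 1 ∧ p.derivative.eval x = 1) → S.card + j ≤ n

theorem Config.reflect {n j : ℕ} {α E : ℝ} {p : ℝ[X]} {z : ℕ → ℝ} (h : Config n α E p j z) :
    Config n (-α) E (p.comp (-X)) (n + 1 - j) (fun i => -z (n + 1 - i)) := by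
  have hj := h.le
  have hj' := h.pos
  refine ⟨by omega, by omega, ?_, ?_, ?_, ?_, fun S hS => ?_, fun S hS => ?_⟩
  · have := h.osc.reflect
    rw [neg_neg] at this
    convert this using 1
    have e : n + 1 + j = (n + 1 - j) + 2 * j := by omega
    rw [neg_mul, ← pow_add, add_comm j, e, pow_add, pow_mul]; simp
  · simp [h.last]
  · simp [h.zero]
  · rw [Nat.sub_sub_self (by omega), h.corner]
  · have := h.right (S.map (Equiv.neg ℝ).toEmbedding) fun x hx => by
      obtain ⟨y, hy, rfl⟩ := Finset.mem_map.1 hx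
      obtain ⟨h1, h2, h3⟩ := hS y hy
      rw [eval_derivative_comp_neg_X] at h3
      simp only [Equiv.coe_toEmbedding, Equiv.neg_apply]
      exact ⟨by linarith, by linarith, by linarith⟩
    rw [Finset.card_map] at this
    omega
  · have := h.left (S.map (Equiv.neg ℝ).toEmbedding) fun x hx => by
      obtain ⟨y, hy, rfl⟩ := Finset.mem_map.1 hx
      obtain ⟨h1, h2, h3⟩ := hS y hy
      rw [eval_derivative_comp_neg_X] at h3
      simp only [Equiv.coe_toEmbedding, Equiv.neg_apply]
      exact ⟨by linarith, by linarith, by linarith⟩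
    rw [Finset.card_map] at this
    omega

/-- Inner alternation points are critical: `p' = -1` left of the corner, `p' = 1` right of it and at
`w`. Rolle's theorem for the two level sets of `p'` allows at most `n - 1` inner points off the
corner, so all of `-1`, `α`, `1` are needed to reach `n + 2`. -/
theorem exists_index_of_outer_critical {n : ℕ} (hn : 2 ≤ n) {α E ε w : ℝ} {p : ℝ[X]} {z : ℕ → ℝ}
    (hα : α ∈ Ioo (-1 : ℝ) 1) (hE : 0 < E) (hp : p.natDegree ≤ n)
    (h : EquiOsc (n + 1) α E p (-1) 1 z ε) (hw : 1 < w) (hd : p.derivative.eval w = 1) :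
    z 0 = -1 ∧ z (n + 1) = 1 ∧ ∃ j, 2 ≤ j ∧ j ≤ n ∧ z j = α := by
  have hp2 := derivative_derivative_ne_zero hn hE h
  have hp2d := natDegree_derivative_derivative_le hp
  have hext : ∀ i ≤ n + 1, |(|z i - α| - p.eval (z i))| = E := fun i hi => by
    rw [h.alt i hi, abs_mul, abs_of_pos hE]
    rcases sign_mul_neg_one_pow h.sign i with h1 | h1 <;> simp [h1]
  have hinj : InjOn z (Finset.range (n + 2) : Finset ℕ) := h.mono.injOn.mono fun i hi => by
    simp only [Finset.coe_range, mem_Iio] at hi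
    exact mem_Iic.2 (by omega)
  set Z := (Finset.range (n + 2)).image z with hZ
  have hZcard : Z.card = n + 2 := by rw [hZ, Finset.card_image_of_injOn hinj, Finset.card_range]
  have hZmem : ∀ x ∈ Z, ∃ i ≤ n + 1, z i = x := fun x hx => by
    obtain ⟨i, hi, rfl⟩ := Finset.mem_image.1 hx
    exact ⟨i, by have := Finset.mem_range.1 hi; omega, rfl⟩
  set L := Z.filter (fun x => -1 < x ∧ x < α) with hL
  set R := Z.filter (fun x => α < x ∧ x < 1) with hR
  have hLd : ∀ x ∈ L, p.derivative.eval x = -1 := fun x hx => by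
    obtain ⟨hxZ, h1, h2⟩ := Finset.mem_filter.1 hx
    obtain ⟨i, hi, rfl⟩ := hZmem x hxZ
    exact derivative_eval_of_extremal h.bound ⟨h1, h2.trans hα.2⟩ (hext i hi)
      (hasDerivAt_abs_sub_of_lt h2)
  have hRd : ∀ x ∈ R, p.derivative.eval x = 1 := fun x hx => by
    obtain ⟨hxZ, h1, h2⟩ := Finset.mem_filter.1 hx
    obtain ⟨i, hi, rfl⟩ := hZmem x hxZ
    exact derivative_eval_of_extremal h.bound ⟨hα.1.trans h1, h2⟩ (hext i hi)
      (hasDerivAt_abs_sub_of_gt h1)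
  have hwR : w ∉ R := fun hmem => by
    have := (Finset.mem_filter.1 hmem).2.2
    linarith
  have hTd : ∀ x ∈ insert w R, p.derivative.eval x = 1 := fun x hx => by
    rcases Finset.mem_insert.1 hx with rfl | hx
    · exact hd
    · exact hRd x hx
  have hTcard : (insert w R).card = R.card + 1 := Finset.card_insert_of_notMem hwR
  have hLT : ∀ x ∈ L, ∀ y ∈ insert w R, x < y := fun x hx y hy => by
    have h1 := (Finset.mem_filter.1 hx).2.2
    rcases Finset.mem_insert.1 hy with rfl | hy
    · linarith [hα.2]
    · linarith [(Finset.mem_filter.1 hy).2.1]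
  have hsub : Z \ (L ∪ R) ⊆ {-1, α, 1} := by
    intro x hx
    simp only [hL, hR, Finset.mem_sdiff, Finset.mem_union, Finset.mem_filter, not_or, not_and,
      not_lt] at hx
    obtain ⟨hxZ, h1, h2⟩ := hx
    obtain ⟨i, hi, rfl⟩ := hZmem x hxZ
    have hm := h.mem i hi
    simp only [Finset.mem_insert, Finset.mem_singleton]
    rcases hm.1.eq_or_lt with h3 | h3
    · exact Or.inl h3.symm
    · rcases (h1 hxZ h3).eq_or_lt with h4 | h4
      · exact Or.inr (Or.inl h4.symm)
      · exact Or.inr (Or.inr (le_antisymm hm.2 (h2 hxZ h4)))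
  have hcard1 : Z.card ≤ (Z \ (L ∪ R)).card + (L.card + R.card) := by
    have h1 := Finset.card_le_card_sdiff_add_card (s := Z) (t := L ∪ R)
    have h2 := Finset.card_union_le L R
    omega
  have hle3 : ({-1, α, 1} : Finset ℝ).card ≤ 3 := Finset.card_le_three
  have hle := Finset.card_le_card hsub
  -- With no point on the left there is only one level set, and Rolle's bound becomes smaller by
  -- one.
  have hLne : L.Nonempty := by
    by_contra hemp
    rw [Finset.not_nonempty_iff_eq_empty] at hemp
    have := card_level_le hp2 hTd
    have h0 : L.card = 0 := by rw [hemp, Finset.card_empty]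
    omega
  have hsum := card_add_card_level_le hp2 hLd hTd hLT
  have heq := Finset.eq_of_subset_of_card_le hsub (by omega)
  have hin : ∀ x ∈ ({-1, α, 1} : Finset ℝ), ∃ i ≤ n + 1, z i = x := fun x hx => by
    rw [← heq] at hx
    exact hZmem x (Finset.mem_sdiff.1 hx).1
  have hz0 : z 0 = -1 := by
    obtain ⟨i, hi, hzi⟩ := hin (-1) (by simp)
    refine le_antisymm ?_ (h.mem 0 (by omega)).1
    rw [← hzi]
    exact h.mono.monotoneOn (mem_Iic.2 (by omega)) (mem_Iic.2 hi) i.zero_le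
  have hz1 : z (n + 1) = 1 := by
    obtain ⟨i, hi, hzi⟩ := hin 1 (by simp)
    refine le_antisymm (h.mem _ le_rfl).2 ?_
    rw [← hzi]
    exact h.mono.monotoneOn (mem_Iic.2 hi) (mem_Iic.2 le_rfl) hi
  obtain ⟨j, hj, hzj⟩ := hin α (by simp)
  refine ⟨hz0, hz1, j, ?_, ?_, hzj⟩
  · obtain ⟨x, hx⟩ := hLne
    obtain ⟨hxZ, h1, h2⟩ := Finset.mem_filter.1 hx
    obtain ⟨i, hi, rfl⟩ := hZmem x hxZ
    rw [← hz0] at h1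
    rw [← hzj] at h2
    have h3 := (h.mono.lt_iff_lt (mem_Iic.2 (by omega)) (mem_Iic.2 hi)).1 h1
    have h4 := (h.mono.lt_iff_lt (mem_Iic.2 hi) (mem_Iic.2 hj)).1 h2
    omega
  · rcases hj.lt_or_eq with h1 | h1
    · omega
    · rw [h1, hz1] at hzj
      linarith [hα.2]

/-- The interior alternation points on either side of the corner, as critical points. -/
theorem exists_inner_critical {n j : ℕ} {α E ε : ℝ} {p : ℝ[X]} {z : ℕ → ℝ} (hE : 0 < E)
    (h : EquiOsc (n + 1) α E p (-1) 1 z ε) (hj : 0 < j) (hjn : j ≤ n) (hzj : z j = α) :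
    ∃ L R : Finset ℝ, L.card = j - 1 ∧ R.card = n - j ∧
      (∀ x ∈ L, -1 < x ∧ x < α ∧ p.derivative.eval x = -1) ∧
      ∀ x ∈ R, α < x ∧ x ≤ z n ∧ x < 1 ∧ p.derivative.eval x = 1 := by
  have hext : ∀ i ≤ n + 1, |(|z i - α| - p.eval (z i))| = E := fun i hi => by
    rw [h.alt i hi, abs_mul, abs_of_pos hE]
    rcases sign_mul_neg_one_pow h.sign i with h1 | h1 <;> simp [h1]
  have hlow : ∀ i, 0 < i → i ≤ n + 1 → -1 < z i := fun i hi hi' =>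
    (h.mem 0 (by omega)).1.trans_lt (h.mono (mem_Iic.2 (by omega)) (mem_Iic.2 hi') hi)
  have hhigh : ∀ i, i ≤ n → z i < 1 := fun i hi =>
    (h.mono (mem_Iic.2 (by omega)) (mem_Iic.2 le_rfl) (by omega : i < n + 1)).trans_le
      (h.mem _ le_rfl).2
  refine ⟨(Finset.Ioo 0 j).image z, (Finset.Ioc j n).image z, ?_, ?_, fun x hx => ?_,
    fun x hx => ?_⟩
  · rw [Finset.card_image_of_injOn, Nat.card_Ioo]
    · omega
    · refine h.mono.injOn.mono fun i hi => ?_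
      have := Finset.mem_Ioo.1 (Finset.mem_coe.1 hi)
      exact mem_Iic.2 (by omega)
  · rw [Finset.card_image_of_injOn, Nat.card_Ioc]
    refine h.mono.injOn.mono fun i hi => ?_
    have := Finset.mem_Ioc.1 (Finset.mem_coe.1 hi)
    exact mem_Iic.2 (by omega)
  · obtain ⟨i, hi, rfl⟩ := Finset.mem_image.1 hx
    obtain ⟨h1, h2⟩ := Finset.mem_Ioo.1 hi
    have h3 : z i < α := hzj ▸ h.mono (mem_Iic.2 (by omega)) (mem_Iic.2 (by omega)) h2
    have h4 := hlow i h1 (by omega)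
    exact ⟨h4, h3, derivative_eval_of_extremal h.bound ⟨h4, hhigh i (by omega)⟩
      (hext i (by omega)) (hasDerivAt_abs_sub_of_lt h3)⟩
  · obtain ⟨i, hi, rfl⟩ := Finset.mem_image.1 hx
    obtain ⟨h1, h2⟩ := Finset.mem_Ioc.1 hi
    have h3 : α < z i := hzj ▸ h.mono (mem_Iic.2 (by omega)) (mem_Iic.2 (by omega)) h1
    have h4 := hhigh i h2
    exact ⟨h3, h.mono.monotoneOn (mem_Iic.2 (by omega)) (mem_Iic.2 (by omega)) h2, h4,
      derivative_eval_of_extremal h.bound ⟨hlow i (by omega) (by omega), h4⟩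
      (hext i (by omega)) (hasDerivAt_abs_sub_of_gt h3)⟩

/-- The sign of the top coefficient, from the alternation and a critical point beyond `1`. -/
theorem coeff_sign_of_outer_critical {n j : ℕ} (hn : 2 ≤ n) {α E w : ℝ} {p : ℝ[X]} {z : ℕ → ℝ}
    (hE : 0 < E) (hp : p.natDegree ≤ n) (h : EquiOsc (n + 1) α E p (-1) 1 z (-(-1) ^ j))
    (hj : 2 ≤ j) (hjn : j ≤ n) (hzj : z j = α) (hw : 1 < w) (hd : p.derivative.eval w = 1) :
    0 < (-1) ^ (n + j) * p.coeff n := by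
  have hstep : ∀ i ≤ n, z i < z (i + 1) := fun i hi =>
    h.mono (mem_Iic.2 (by omega)) (mem_Iic.2 (by omega)) i.lt_succ_self
  have hle : ∀ i k, i ≤ k → k ≤ n + 1 → z i ≤ z k := fun i k hik hk =>
    h.mono.monotoneOn (mem_Iic.2 (by omega)) (mem_Iic.2 hk) hik
  have hsq : ∀ i, (-(-1 : ℝ) ^ j) * ((-1) ^ i * ((-(-1) ^ j) * (-1) ^ i * E)) = E := fun i => by
    linear_combination (E * ((-1) ^ i * (-1) ^ i)) * neg_one_pow_mul_self j
      + E * neg_one_pow_mul_self i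
  obtain ⟨dL, hdL⟩ := exists_alternating_derivative (f := C α - X - p) (a := 0) (b := j) (d := z)
    (σ := -(-1) ^ j) (fun i _ hi => hstep i (by omega)) fun i _ hi => by
      have h1 := h.alt i (by omega)
      have h2 := hle i j hi (by omega)
      rw [abs_of_nonpos (by linarith)] at h1
      have : (C α - X - p).eval (z i) = -(z i - α) - p.eval (z i) := by simp
      rw [this, h1, hsq]; exact hE.le
  obtain ⟨dR, hdR⟩ := exists_alternating_derivative (f := X - C α - p) (a := j) (b := n + 1)
    (d := z) (σ := -(-1) ^ j) (fun i _ hi => hstep i (by omega)) fun i hi hi' => by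
      have h1 := h.alt i hi'
      have h2 := hle j i hi hi'
      rw [abs_of_nonneg (by linarith)] at h1
      have : (X - C α - p).eval (z i) = (z i - α) - p.eval (z i) := by simp
      rw [this, h1, hsq]; exact hE.le
  -- The outer critical point extends the sequence; the derivative of the right branch is zero
  -- there, which fits a weak alternation.
  set dR' : ℕ → ℝ := fun i => if i ≤ n then dR i else w with hdR'
  have hdR'1 : ∀ i ≤ n, dR' i = dR i := fun i hi => by simp [hdR', hi]
  have hdR'2 : dR' (n + 1) = w := by simp [hdR']
  obtain ⟨cL, hcL⟩ := exists_alternating_derivative (f := (C α - X - p).derivative) (a := 0)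
    (b := j - 1) (d := dL) (σ := - -(-1) ^ j)
    (fun i _ hi => (hdL i (by omega) (by omega)).2.1.trans (hdL (i + 1) (by omega) (by omega)).1)
    fun i _ hi => (hdL i (by omega) (by omega)).2.2
  obtain ⟨cR, hcR⟩ := exists_alternating_derivative (f := (X - C α - p).derivative) (a := j)
    (b := n + 1) (d := dR') (σ := - -(-1) ^ j)
    (fun i hi hi' => by
      rw [hdR'1 i (by omega)]
      rcases Nat.lt_or_ge i n with h1 | h1
      · rw [hdR'1 (i + 1) h1]
        exact (hdR i hi hi').2.1.trans (hdR (i + 1) (by omega) (by omega)).1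
      · obtain rfl : i = n := by omega
        rw [hdR'2]
        exact (hdR i hi hi').2.1.trans ((h.mem _ le_rfl).2.trans_lt hw))
    fun i hi hi' => by
      rcases Nat.lt_or_ge n i with h1 | h1
      · obtain rfl : i = n + 1 := by omega
        rw [hdR'2]
        simp [hd]
      · rw [hdR'1 i h1]
        exact (hdR i hi (by omega)).2.2
  have hcLα : ∀ i, i + 1 < j → cL i < α := fun i hi => by
    have h1 := (hcL i (by omega) (by omega)).2.1
    have h2 := (hdL (i + 1) (by omega) hi).2.1
    have h3 := hle (i + 2) j (by omega) (by omega)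
    have h4 : z (i + 1 + 1) = z (i + 2) := rfl
    linarith
  have hcRα : ∀ i, j ≤ i → i ≤ n → α < cR i := fun i hi hi' => by
    have h1 := (hcR i hi (by omega)).1
    rw [hdR'1 i hi'] at h1
    have h2 := (hdR i hi (by omega)).1
    have h3 := hle j i hi (by omega)
    linarith
  have hqL : ∀ x, (C α - X - p).derivative.derivative.eval x = -p.derivative.derivative.eval x :=
    fun x => by simp
  have hqR : ∀ x, (X - C α - p).derivative.derivative.eval x = -p.derivative.derivative.eval x :=
    fun x => by simp
  -- The values at `cL (j - 2)` and `cR j` have the same weak sign, so `cL (j - 2)` is dropped. The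
  -- `n - 1` points left determine the sign of the top coefficient.
  have hmono : StrictMonoOn (fun i => if i + 2 < j then cL i else cR (i + 2)) (Iic (n - 2)) := by
    refine strictMonoOn_Iic_of_lt_succ fun i hi => ?_
    split_ifs with h1 h2 h2
    · exact (hcL i (by omega) (by omega)).2.1.trans (hcL (i + 1) (by omega) (by omega)).1
    · exact (hcLα i (by omega)).trans (hcRα _ (by omega) (by omega))
    · omega
    · exact (hcR (i + 2) (by omega) (by omega)).2.1.trans (hcR (i + 2 + 1) (by omega) (by omega)).1
  have key := coeff_pos_of_weak_alternation (natDegree_derivative_derivative_le hp)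
    (derivative_derivative_ne_zero hn hE h) hmono (σ := (-1) ^ j) (by simp) fun i hi => by
      split_ifs with h1
      · have := (hcL i (by omega) (by omega)).2.2
        rw [hqL] at this
        linarith
      · have := (hcR (i + 2) (by omega) (by omega)).2.2
        rw [hqR, pow_add] at this
        linarith
  rw [coeff_derivative, coeff_derivative] at key
  obtain ⟨k, rfl⟩ : ∃ k, n = k + 2 := ⟨n - 2, by omega⟩
  simp only [Nat.add_sub_cancel] at key
  have hk : (0 : ℝ) < (((k + 1 : ℕ) : ℝ) + 1) * ((k : ℝ) + 1) := by positivity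
  have e : (-1 : ℝ) ^ (k + 2 + j) = (-1) ^ j * (-1) ^ k := by
    rw [pow_add, pow_add]; ring
  rw [e]
  refine pos_of_mul_pos_left (b := (((k + 1 : ℕ) : ℝ) + 1) * ((k : ℝ) + 1)) ?_ hk.le
  have e2 : p.coeff (k + 2) = p.coeff (k + 1 + 1) := rfl
  rw [e2]
  linarith

/-- The configuration of a minimax polynomial with a critical point beyond `1`. -/
theorem exists_config_of_outer_critical {n : ℕ} (hn : 2 ≤ n) {α w : ℝ} {p : ℝ[X]}
    (hα : α ∈ Ioo (-1 : ℝ) 1) (hp : IsMinimax n α p) (hw : 1 < w)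
    (hd : p.derivative.eval w = 1) :
    ∃ j z, Config n α (minimaxError n α) p j z ∧ 2 ≤ j ∧
      (∀ x ∈ Ioo 1 w, 0 < (-1) ^ (n + 1 + j) * (p.derivative.eval x - 1)) ∧
      0 < (-1) ^ (n + j) * p.coeff n := by
  have hE := minimaxError_pos n hα
  obtain ⟨z, ε, h⟩ := exists_equiOsc_of_isMinimax (by omega) hα hp
  set E := minimaxError n α
  obtain ⟨hz0, hz1, j, hj, hjn, hzj⟩ := exists_index_of_outer_critical hn hα hE hp.1 h hw hd
  -- The error at the corner is extremal and not `E`, hence `-E`; this fixes the sign.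
  obtain rfl : ε = -(-1) ^ j := by
    have h1 := h.alt j (by omega)
    rw [hzj] at h1
    have h2 := error_corner_ne hα h.bound
    rw [h1] at h2
    have h3 : ε * (-1) ^ j ≠ 1 := fun h3 => h2 (by rw [h3, one_mul])
    have h4 := (sign_mul_neg_one_pow h.sign j).resolve_left h3
    linear_combination ((-1) ^ j) * h4 - ε * neg_one_pow_mul_self j
  have hp2 := derivative_derivative_ne_zero hn hE h
  have hp2d := natDegree_derivative_derivative_le hp.1
  obtain ⟨L, R, hLc, hRc, hL, hR⟩ := exists_inner_critical hE h (by omega) hjn hzj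
  have hwα : α < w := hα.2.trans hw
  -- `R` together with `w` attains this bound, so no other critical point lies to the right of the
  -- corner.
  have hright : ∀ S : Finset ℝ, (∀ x ∈ S, α < x ∧ p.derivative.eval x = 1) →
      S.card + j ≤ n + 1 := fun S hS => by
    have := card_add_card_level_le hp2 (fun x hx => (hL x hx).2.2) (fun x hx => (hS x hx).2)
      fun x hx y hy => (hL x hx).2.1.trans (hS y hy).1
    omega
  have hwR : w ∉ R := fun hmem => by linarith [(hR w hmem).2.2.1]
  refine ⟨j, z, ⟨by omega, hjn, h, hz0, hz1, hzj, fun S hS => ?_, fun S hS => ?_⟩, hj, ?_,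
    coeff_sign_of_outer_critical hn hE hp.1 h hj hjn hzj hw hd⟩
  · have hT : ∀ x ∈ insert w R, α < x ∧ p.derivative.eval x = 1 := fun x hx => by
      rcases Finset.mem_insert.1 hx with rfl | hx
      · exact ⟨hwα, hd⟩
      · exact ⟨(hR x hx).1, (hR x hx).2.2.2⟩
    have := card_add_card_level_le hp2 (fun x hx => (hS x hx).2.2) (fun x hx => (hT x hx).2)
      fun x hx y hy => (hS x hx).2.1.trans (hT y hy).1
    rw [Finset.card_insert_of_notMem hwR] at this
    omega
  · have hwS : w ∉ S := fun hmem => by linarith [(hS w hmem).2.1]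
    have := hright (insert w S) fun x hx => by
      rcases Finset.mem_insert.1 hx with rfl | hx
      · exact ⟨hwα, hd⟩
      · exact ⟨(hS x hx).1, (hS x hx).2.2⟩
    rw [Finset.card_insert_of_notMem hwS] at this
    omega
  · have hzn : α ≤ z n := hzj ▸ h.mono.monotoneOn (mem_Iic.2 (by omega)) (mem_Iic.2 (by omega)) hjn
    have hzn1 : z n < 1 := hz1 ▸ h.mono (mem_Iic.2 (by omega)) (mem_Iic.2 le_rfl) n.lt_succ_self
    set τ : ℝ := (-1) ^ (n + 1 + j) with hτ
    have hττ : τ * τ = 1 := neg_one_pow_mul_self _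
    have hτ0 : τ ≠ 0 := fun h0 => by simp [h0] at hττ
    set r : ℝ[X] := C τ * (p.derivative - 1) with hr
    have hre : ∀ x, r.eval x = τ * (p.derivative.eval x - 1) := fun x => by simp [hr]
    have hne : ∀ x ∈ Ioo (z n) w, r.eval x ≠ 0 := by
      intro x hx h0
      rw [hre] at h0
      have hx1 : p.derivative.eval x = 1 := by
        rcases mul_eq_zero.1 h0 with h1 | h1
        · exact absurd h1 hτ0
        · linarith
      have hxR : x ∉ R := fun hmem => absurd (hR x hmem).2.1 (not_le.2 hx.1)
      have hwxR : w ∉ insert x R := fun hmem => by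
        rcases Finset.mem_insert.1 hmem with h1 | h1
        · exact absurd h1 hx.2.ne'
        · exact hwR h1
      have := hright (insert w (insert x R)) fun y hy => by
        rcases Finset.mem_insert.1 hy with rfl | hy
        · exact ⟨hwα, hd⟩
        rcases Finset.mem_insert.1 hy with rfl | hy
        · exact ⟨hzn.trans_lt hx.1, hx1⟩
        · exact ⟨(hR y hy).1, (hR y hy).2.2.2⟩
      rw [Finset.card_insert_of_notMem hwxR, Finset.card_insert_of_notMem hxR] at this
      omega
    -- `p' - 1` keeps its sign on `(z n, w)`. It is read off between the last two alternation
    -- points, across which the error changes by `2 * E` in absolute value.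
    obtain ⟨d, hdm, hds⟩ := exists_deriv_eq_slope (fun x => p.eval x) hzn1
      p.continuous.continuousOn p.differentiable.differentiableOn
    rw [Polynomial.deriv, eq_div_iff (by linarith)] at hds
    have hpos : 0 < r.eval d := by
      have h1 := h.alt n (by omega)
      have h2 := h.alt (n + 1) le_rfl
      rw [hz1, abs_of_pos (by linarith [hα.2])] at h2
      rw [abs_of_nonneg (by linarith)] at h1
      have e1 : (-(-1 : ℝ) ^ j) * (-1) ^ (n + 1) = -τ := by rw [hτ, pow_add _ (n + 1)]; ring
      have e2 : (-(-1 : ℝ) ^ j) * (-1) ^ n = τ := by rw [hτ, pow_add _ (n + 1), pow_succ]; ring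
      rw [e1] at h2
      rw [e2] at h1
      have h3 : r.eval d * (1 - z n) = 2 * E := by
        rw [hre]
        linear_combination τ * hds + 2 * E * hττ - τ * h2 + τ * h1
      have h4 : 0 < r.eval d * (1 - z n) := by rw [h3]; positivity
      exact pos_of_mul_pos_left h4 (by linarith)
    intro x hx
    rw [← hre]
    exact eval_pos_of_forall_ne_zero ordConnected_Ioo hne ⟨hdm.1, hdm.2.trans hw⟩
      ⟨hzn1.trans hx.1, hx.2⟩ hpos

/-! ### Comparison of two corners -/

theorem derivative_eq_zero_of_sign {f : ℝ[X]} (hf : f.derivative.derivative = 0) {x y s : ℝ}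
    (hs : s ≠ 0) (hx : 0 ≤ s * f.derivative.eval x) (hy : 0 ≤ -s * f.derivative.eval y) :
    f.derivative = 0 := by
  have h := eq_C_of_natDegree_eq_zero (derivative_eq_zero.1 hf)
  set a := f.derivative.coeff 0
  rw [h, eval_C] at hx hy
  have : s * a = 0 := by linarith
  rw [h, (mul_eq_zero.1 this).resolve_left hs, C_0]

theorem eq_zero_of_derivative_eq_zero {f : ℝ[X]} (hf : f.derivative = 0) {x : ℝ}
    (hx : f.eval x = 0) : f = 0 := by
  have h := eq_C_of_natDegree_eq_zero (derivative_eq_zero.1 hf)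
  rw [h, eval_C] at hx
  rw [h, hx, C_0]

/-- `L` and `R` are the differences of the left and of the right branches of the errors, normalized
by `E` and `F`. They have the same second derivative, as they differ from `P` by affine terms. Left
of `α` the error for `α` is extremal at the `y i`, right of `β` the error for `β` is extremal at the
`z i`, and the other error stays in the band; hence the weak alternations, with opposite
orientations. -/
theorem outer_critical_lt {n j : ℕ} (hn : 2 ≤ n) {α β E F v w : ℝ} {p q : ℝ[X]} {y z : ℕ → ℝ}
    (hαβ : α < β) (hE : 0 < E) (hF : 0 < F) (hp : p.natDegree ≤ n)
    (hq : q.natDegree ≤ n) (hy : Config n α E p j y) (hz : Config n β F q j z) (hj : 2 ≤ j)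
    (hv : p.derivative.eval v = 1)
    (hvs : ∀ x ∈ Ioo 1 v, 0 < (-1) ^ (n + 1 + j) * (p.derivative.eval x - 1))
    (hw1 : 1 < w) (hw : q.derivative.eval w = 1) : v < w := by
  by_contra! hwv
  have hjn := hy.le
  set P : ℝ[X] := C E⁻¹ * p - C F⁻¹ * q with hP
  set L : ℝ[X] := P + C E⁻¹ * (X - C α) - C F⁻¹ * (X - C β) with hL
  set R : ℝ[X] := P - C E⁻¹ * (X - C α) + C F⁻¹ * (X - C β) with hR
  have hLe : ∀ x, L.eval x = F⁻¹ * (-(x - β) - q.eval x) - E⁻¹ * (-(x - α) - p.eval x) :=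
      fun x => by
    simp only [hL, hP, eval_add, eval_sub, eval_mul, eval_C, eval_X]; ring
  have hRe : ∀ x, R.eval x = F⁻¹ * ((x - β) - q.eval x) - E⁻¹ * ((x - α) - p.eval x) :=
      fun x => by
    simp only [hR, hP, eval_add, eval_sub, eval_mul, eval_C, eval_X]; ring
  have hL2 : L.derivative.derivative = P.derivative.derivative := by simp [hL]
  have hR2 : R.derivative.derivative = P.derivative.derivative := by simp [hR]
  have hRd : ∀ x, R.derivative.eval x
      = E⁻¹ * (p.derivative.eval x - 1) - F⁻¹ * (q.derivative.eval x - 1) := fun x => by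
    simp only [hR, hP, derivative_add, derivative_sub, derivative_mul, derivative_C, derivative_X,
      eval_add, eval_sub, eval_mul, eval_C, eval_one, eval_zero]
    ring
  have hone : ∀ i, ((-1 : ℝ) ^ j * (-1) ^ i) * ((-1) ^ j * (-1) ^ i) = 1 := fun i => by
    linear_combination ((-1) ^ i * (-1) ^ i) * neg_one_pow_mul_self j + neg_one_pow_mul_self i
  have habs : ∀ i, |(-1 : ℝ) ^ j * (-1) ^ i| = 1 := fun i => by simp
  have hEb : ∀ x ∈ Icc (-1 : ℝ) 1, ∀ i,
      |(-1) ^ j * (-1) ^ i * (E⁻¹ * (|x - α| - p.eval x))| ≤ 1 := fun x hx i => by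
    rw [abs_mul, habs, one_mul, abs_mul, abs_of_pos (inv_pos.2 hE), inv_mul_le_iff₀ hE, mul_one]
    exact hy.osc.bound x hx
  have hFb : ∀ x ∈ Icc (-1 : ℝ) 1, ∀ i,
      |(-1) ^ j * (-1) ^ i * (F⁻¹ * (|x - β| - q.eval x))| ≤ 1 := fun x hx i => by
    rw [abs_mul, habs, one_mul, abs_mul, abs_of_pos (inv_pos.2 hF), inv_mul_le_iff₀ hF, mul_one]
    exact hz.osc.bound x hx
  have hEa : ∀ i ≤ n + 1, (-1) ^ j * (-1) ^ i * (E⁻¹ * (|y i - α| - p.eval (y i))) = -1 :=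
    fun i hi => by
      rw [hy.osc.alt i hi]
      linear_combination (-1 : ℝ) * hone i
        - ((-1) ^ j * (-1) ^ i) * ((-1) ^ j * (-1) ^ i) * inv_mul_cancel₀ hE.ne'
  have hFa : ∀ i ≤ n + 1, (-1) ^ j * (-1) ^ i * (F⁻¹ * (|z i - β| - q.eval (z i))) = -1 :=
    fun i hi => by
      rw [hz.osc.alt i hi]
      linear_combination (-1 : ℝ) * hone i
        - ((-1) ^ j * (-1) ^ i) * ((-1) ^ j * (-1) ^ i) * inv_mul_cancel₀ hF.ne'
  have hyα : ∀ i ≤ j, y i ≤ α := fun i hi =>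
    hy.corner ▸ hy.osc.mono.monotoneOn (mem_Iic.2 (by omega)) (mem_Iic.2 (by omega)) hi
  have hzβ : ∀ i, j ≤ i → i ≤ n + 1 → β ≤ z i := fun i hi hi' =>
    hz.corner ▸ hz.osc.mono.monotoneOn (mem_Iic.2 (by omega)) (mem_Iic.2 hi') hi
  obtain ⟨dL, hdL⟩ := exists_alternating_derivative (f := L) (a := 0) (b := j) (d := y)
    (σ := (-1) ^ j) (fun i _ hi => hy.osc.mono (mem_Iic.2 (by omega)) (mem_Iic.2 (by omega))
      i.lt_succ_self) fun i _ hi => by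
      have h0 := hyα i hi
      have h1 := hEa i (by omega)
      have h2 := hFb (y i) (hy.osc.mem i (by omega)) i
      rw [abs_of_nonpos (by linarith)] at h1
      rw [abs_of_nonpos (by linarith : y i - β ≤ 0)] at h2
      rw [hLe, ← mul_assoc, mul_sub, h1]
      linarith [(abs_le.1 h2).1]
  obtain ⟨dR, hdR⟩ := exists_alternating_derivative (f := R) (a := j) (b := n + 1) (d := z)
    (σ := -(-1) ^ j) (fun i _ hi => hz.osc.mono (mem_Iic.2 (by omega)) (mem_Iic.2 (by omega))
      i.lt_succ_self) fun i hi hi' => by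
      have h0 := hzβ i hi hi'
      have h1 := hFa i hi'
      have h2 := hEb (z i) (hz.osc.mem i hi') i
      rw [abs_of_nonneg (by linarith)] at h1
      rw [abs_of_nonneg (by linarith : 0 ≤ z i - α)] at h2
      rw [hRe, neg_mul, ← mul_assoc, mul_sub, h1]
      linarith [(abs_le.1 h2).1]
  set dR' : ℕ → ℝ := fun i => if i ≤ n then dR i else w with hdR'
  have hdR'1 : ∀ i ≤ n, dR' i = dR i := fun i hi => by simp [hdR', hi]
  have hdR'2 : dR' (n + 1) = w := by simp [hdR']
  -- The only use of `w ≤ v`: at `w` the contribution of `q` to `R'` vanishes, and the sign of `p' -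
  -- 1` is known up to `v`.
  have hwsign : 0 ≤ (-1) ^ j * ((-1) ^ (n + 1) * R.derivative.eval w) := by
    have h1 : 0 ≤ (-1) ^ (n + 1 + j) * (p.derivative.eval w - 1) := by
      rcases hwv.lt_or_eq with h | h
      · exact (hvs w ⟨hw1, h⟩).le
      · rw [h, hv]; simp
    rw [hRd, hw]
    have e : (-1) ^ j * ((-1) ^ (n + 1) * (E⁻¹ * (p.derivative.eval w - 1) - F⁻¹ * (1 - 1)))
        = E⁻¹ * ((-1) ^ (n + 1 + j) * (p.derivative.eval w - 1)) := by
      rw [pow_add _ (n + 1)]; ring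
    rw [e]
    exact mul_nonneg (inv_pos.2 hE).le h1
  obtain ⟨cL, hcL⟩ := exists_alternating_derivative (f := L.derivative) (a := 0)
    (b := j - 1) (d := dL) (σ := -(-1) ^ j)
    (fun i _ hi => (hdL i (by omega) (by omega)).2.1.trans (hdL (i + 1) (by omega) (by omega)).1)
    fun i _ hi => (hdL i (by omega) (by omega)).2.2
  obtain ⟨cR, hcR⟩ := exists_alternating_derivative (f := R.derivative) (a := j)
    (b := n + 1) (d := dR') (σ := (-1) ^ j)
    (fun i hi hi' => by
      rw [hdR'1 i (by omega)]
      rcases Nat.lt_or_ge i n with h1 | h1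
      · rw [hdR'1 (i + 1) h1]
        exact (hdR i hi hi').2.1.trans (hdR (i + 1) (by omega) (by omega)).1
      · obtain rfl : i = n := by omega
        rw [hdR'2]
        exact (hdR i hi hi').2.1.trans ((hz.osc.mem _ le_rfl).2.trans_lt hw1))
    fun i hi hi' => by
      rcases Nat.lt_or_ge n i with h1 | h1
      · obtain rfl : i = n + 1 := by omega
        rw [hdR'2]
        exact hwsign
      · rw [hdR'1 i h1]
        have := (hdR i hi (by omega)).2.2
        rwa [neg_neg] at this
  have hcLα : ∀ i, i + 1 < j → cL i < α := fun i hi => by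
    have h1 := (hcL i (by omega) (by omega)).2.1
    have h2 := (hdL (i + 1) (by omega) hi).2.1
    have h3 := hyα (i + 1 + 1) (by omega)
    linarith
  have hcRβ : ∀ i, j ≤ i → i ≤ n → β < cR i := fun i hi hi' => by
    have h1 := (hcR i hi (by omega)).1
    rw [hdR'1 i hi'] at h1
    have h2 := (hdR i hi (by omega)).1
    have h3 := hzβ i hi (by omega)
    linarith
  have hPdeg : P.natDegree ≤ n := (natDegree_sub_le _ _).trans
    (max_le ((natDegree_C_mul_le _ _).trans hp) ((natDegree_C_mul_le _ _).trans hq))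
  -- There are `j - 1` points on the left and `n + 1 - j` on the right, together `n`, two more than
  -- the degree bound `n - 2`. The index shift by one absorbs the opposite orientations of `L` and
  -- `R`.
  have hmono : StrictMonoOn (fun i => if i + 1 < j then cL i else cR (i + 1))
      (Iic (n - 2 + 1)) := by
    refine strictMonoOn_Iic_of_lt_succ fun i hi => ?_
    split_ifs with h1 h2 h2
    · exact (hcL i (by omega) (by omega)).2.1.trans (hcL (i + 1) (by omega) (by omega)).1
    · exact ((hcLα i h1).trans hαβ).trans (hcRβ _ (by omega) (by omega))
    · omega
    · exact (hcR (i + 1) (by omega) (by omega)).2.1.trans (hcR (i + 1 + 1) (by omega) (by omega)).1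
  have hP0 : P.derivative.derivative = 0 := by
    refine eq_zero_of_weak_alternation (natDegree_derivative_derivative_le hPdeg) hmono
      (σ := (-1) ^ j) (by simp) fun i hi => ?_
    split_ifs with h1
    · have := (hcL i (by omega) (by omega)).2.2
      rw [hL2] at this
      linarith
    · have := (hcR (i + 1) (by omega) (by omega)).2.2
      rw [hR2, pow_succ] at this
      linarith
  have hj0 : ((-1 : ℝ) ^ j) ≠ 0 := by simp
  have hn0 : ((-1 : ℝ) ^ n) ≠ 0 := by simp
  -- A constant with both weak signs is zero; two mean value points on the left exist because `j ≥
  -- 2`.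
  have hL1 : L.derivative = 0 := by
    have h0 := (hdL 0 (by omega) (by omega)).2.2
    have h1 := (hdL 1 (by omega) (by omega)).2.2
    exact derivative_eq_zero_of_sign (hL2.trans hP0) (x := dL 1) (y := dL 0) hj0
      (by linarith) (by linarith)
  have hR1 : R.derivative = 0 := by
    have h0 := (hdR n hjn (by omega)).2.2
    rw [pow_succ] at hwsign
    exact derivative_eq_zero_of_sign (hR2.trans hP0) (x := dR n) (y := w) (mul_ne_zero hj0 hn0)
      (by linarith) (by linarith)
  have hL0 : L = 0 := by
    refine eq_zero_of_derivative_eq_zero hL1 (x := -1) ?_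
    have h1 := hEa 0 (by omega)
    have h2 := hFa 0 (by omega)
    have h3 := hyα 0 (by omega)
    rw [hy.zero] at h1 h3
    rw [hz.zero] at h2
    rw [abs_of_nonpos (by linarith)] at h1 h2
    rw [hLe]
    simp only [pow_zero, mul_one] at h1 h2
    exact sub_eq_zero.2 (mul_left_cancel₀ hj0 (h2.trans h1.symm))
  have hR0 : R = 0 := by
    refine eq_zero_of_derivative_eq_zero hR1 (x := 1) ?_
    have h1 := hEa (n + 1) le_rfl
    have h2 := hFa (n + 1) le_rfl
    have h3 := hzβ (n + 1) (by omega) le_rfl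
    rw [hy.last] at h1
    rw [hz.last] at h2 h3
    rw [abs_of_nonneg (by linarith)] at h1 h2
    rw [hRe]
    exact sub_eq_zero.2 (mul_left_cancel₀ (mul_ne_zero hj0 (by simp)) (h2.trans h1.symm))
  -- `L - R` at `α` equals `2 * F⁻¹ * (β - α)`, which cannot vanish.
  have h1 := hLe α
  have h2 := hRe α
  rw [hL0, eval_zero] at h1
  rw [hR0, eval_zero] at h2
  have h3 : F⁻¹ * (β - α) = 0 := by linarith
  have h4 : 0 < F⁻¹ * (β - α) := mul_pos (inv_pos.2 hF) (by linarith)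
  linarith

/-! ### Continuous dependence on the corner -/

theorem approxError_le_add (α β : ℝ) (q : ℝ[X]) :
    approxError α q ≤ approxError β q + |β - α| := by
  refine approxError_le fun x hx => ?_
  have h1 := abs_error_le β q hx
  have h2 : |(|x - α| - |x - β|)| ≤ |β - α| := by
    refine (abs_abs_sub_abs_le_abs_sub _ _).trans (le_of_eq ?_)
    congr 1; ring
  calc |(|x - α| - q.eval x)| = |(|x - β| - q.eval x) + (|x - α| - |x - β|)| := by ring_nf
    _ ≤ _ := (abs_add_le _ _).trans (add_le_add h1 h2)

/-- Strong uniqueness: minimax polynomials depend on the corner in a Lipschitz way. -/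
theorem exists_lipschitz_bound {n : ℕ} {α E ε : ℝ} {p : ℝ[X]} {z : ℕ → ℝ} (hp : p.natDegree ≤ n)
    (h : EquiOsc (n + 1) α E p (-1) 1 z ε) (Λ : ℝ[X] →ₗ[ℝ] ℝ) :
    ∃ K, ∀ β q, IsMinimax n β q → |Λ q - Λ p| ≤ K * |β - α| := by
  obtain ⟨c, hc, hsum⟩ := exists_pos_weights h.mono
  set s := Finset.range (n + 2) with hs
  have hsmem : ∀ i ∈ s, i ≤ n + 1 := fun i hi => by
    have := Finset.mem_range.1 hi
    omega
  set W := ∑ i ∈ s, c i with hW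
  refine ⟨∑ i ∈ s, (2 + 2 * W / c i) * |Λ (Lagrange.basis s z i)|, fun β q hq => ?_⟩
  set δ := 2 * |β - α| with hδ
  have hδ0 : 0 ≤ δ := by positivity
  have hD : (q - p).natDegree ≤ n := (natDegree_sub_le _ _).trans (max_le hq.1 hp)
  have hpE : approxError α p ≤ E := approxError_le h.bound
  have hqE : approxError α q ≤ E + δ := by
    have h1 := approxError_le_add α β q
    have h2 := hq.2 p hp
    have h3 := approxError_le_add β α p
    rw [abs_sub_comm] at h3
    linarith
  set a : ℕ → ℝ := fun i => ε * ((-1) ^ i * (q - p).eval (z i)) with ha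
  have hsgn : ∀ i, |ε * (-1) ^ i| = 1 := fun i => by
    rcases sign_mul_neg_one_pow h.sign i with h1 | h1 <;> simp [h1]
  have halow : ∀ i ∈ s, -δ ≤ a i := by
    intro i hi
    have h1 := abs_error_le α q (h.mem i (hsmem i hi))
    have h2 : |ε * (-1) ^ i * (|z i - α| - q.eval (z i))| ≤ E + δ := by
      rw [abs_mul, hsgn, one_mul]; exact h1.trans hqE
    have h3 := h.alt i (hsmem i hi)
    have h4 : ε * (-1) ^ i * (|z i - α| - p.eval (z i)) = E := by
      rw [h3]
      linear_combination (E * ((-1) ^ i * (-1) ^ i)) * sq_eq_one_of_sign h.sign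
        + E * neg_one_pow_mul_self i
    have h5 := (abs_le.1 h2).2
    simp only [ha, eval_sub]
    linarith
  -- The sum is, up to sign, the coefficient of `x ^ (n + 1)` in `q - p`. With it, the lower bounds
  -- on the `a i` also yield upper bounds.
  have hasum : ∑ i ∈ s, c i * a i = 0 := by
    have h1 := hsum (q - p) (hD.trans n.le_succ)
    rw [coeff_eq_zero_of_natDegree_lt (by omega), mul_zero] at h1
    calc ∑ i ∈ s, c i * a i = ε * ∑ i ∈ s, c i * ((-1) ^ i * (q - p).eval (z i)) := by
          rw [Finset.mul_sum]; exact Finset.sum_congr rfl fun i _ => by simp only [ha]; ring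
      _ = 0 := by rw [hs, ← h1, mul_zero]
  have hW0 : 0 ≤ W := Finset.sum_nonneg fun i hi => (hc i (hsmem i hi)).le
  have hbound : ∀ i ∈ s, |(q - p).eval (z i)| ≤ (1 + W / c i) * δ := by
    intro i hi
    have hci := hc i (hsmem i hi)
    have h1 : c i * (a i + δ) ≤ W * δ := by
      calc c i * (a i + δ) ≤ ∑ k ∈ s, c k * (a k + δ) :=
            Finset.single_le_sum (f := fun k => c k * (a k + δ)) (fun k hk =>
              mul_nonneg (hc k (hsmem k hk)).le (by linarith [halow k hk])) hi
        _ = W * δ := by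
            simp only [mul_add]
            rw [Finset.sum_add_distrib, hasum, zero_add, ← Finset.sum_mul]
    have h2 : a i + δ ≤ W / c i * δ := by
      rw [div_mul_eq_mul_div, le_div_iff₀ hci]; linarith
    have h3 : |(q - p).eval (z i)| = |a i| := by
      simp only [ha]
      rw [← mul_assoc, abs_mul, hsgn, one_mul]
    rw [h3, abs_le]
    have h4 : 0 ≤ W / c i * δ := by positivity
    have h5 := halow i hi
    constructor <;> linarith
  have hinj : InjOn z (s : Set ℕ) := h.mono.injOn.mono fun i hi => mem_Iic.2 (hsmem i hi)
  have hinterp := Lagrange.eq_interpolate (f := q - p) hinj (by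
    rw [hs, Finset.card_range]
    refine (degree_le_of_natDegree_le hD).trans_lt ?_
    exact_mod_cast (by omega : n < n + 2))
  have hΛ : Λ q - Λ p = ∑ i ∈ s, (q - p).eval (z i) * Λ (Lagrange.basis s z i) := by
    rw [← map_sub]
    conv_lhs => rw [hinterp, Lagrange.interpolate_apply]
    rw [map_sum]
    refine Finset.sum_congr rfl fun i _ => ?_
    rw [← smul_eq_C_mul, map_smul, smul_eq_mul]
  rw [hΛ, Finset.sum_mul]
  refine (Finset.abs_sum_le_sum_abs _ _).trans (Finset.sum_le_sum fun i hi => ?_)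
  rw [abs_mul]
  have := mul_le_mul_of_nonneg_right (hbound i hi) (abs_nonneg (Λ (Lagrange.basis s z i)))
  refine this.trans (le_of_eq ?_)
  rw [hδ]; ring

theorem tendsto_minimaxPoly {n : ℕ} (hn : 1 ≤ n) {α : ℝ} (hα : α ∈ Ioo (-1 : ℝ) 1)
    (Λ : ℝ[X] →ₗ[ℝ] ℝ) :
    Filter.Tendsto (fun β => Λ (minimaxPoly n β)) (nhds α) (nhds (Λ (minimaxPoly n α))) := by
  have hp := isMinimax_minimaxPoly n α
  obtain ⟨z, ε, h⟩ := exists_equiOsc_of_isMinimax hn hα hp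
  obtain ⟨K, hK⟩ := exists_lipschitz_bound hp.1 h Λ
  rw [tendsto_iff_dist_tendsto_zero]
  refine squeeze_zero (fun _ => dist_nonneg)
    (fun β => (Real.dist_eq _ _).trans_le (hK β _ (isMinimax_minimaxPoly n β))) ?_
  have hcont : Continuous fun β : ℝ => K * |β - α| := by fun_prop
  simpa using hcont.tendsto α

/-! ### Constancy of the index and the side; part (ii) -/

/-- A strictly alternating sequence of values forces critical points. -/
theorem exists_critical_of_alternation {f : ℝ[X]} {a b : ℕ} {u : ℕ → ℝ} {σ : ℝ}
    (hu : ∀ i, a ≤ i → i < b → u i < u (i + 1))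
    (hf : ∀ i, a ≤ i → i ≤ b → 0 < σ * (-1) ^ i * f.eval (u i)) :
    ∃ T : Finset ℝ, b - a ≤ T.card + 1 ∧
      ∀ t ∈ T, u a < t ∧ t < u b ∧ f.derivative.eval t = 0 := by
  have hroot : ∀ i, ∃ x, a ≤ i → i < b → u i < x ∧ x < u (i + 1) ∧ f.eval x = 0 := by
    intro i
    by_cases h : a ≤ i ∧ i < b
    · have h1 := hf i h.1 h.2.le
      have h2 := hf (i + 1) (by omega) h.2
      by_contra! hcon
      have hne : ∀ x ∈ Icc (u i) (u (i + 1)), (C (σ * (-1) ^ i) * f).eval x ≠ 0 := by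
        intro x hx h0
        rw [eval_mul, eval_C] at h0
        have hx0 : f.eval x = 0 := by
          rcases mul_eq_zero.1 h0 with h3 | h3
          · rw [h3, zero_mul] at h1; exact absurd h1 (lt_irrefl _)
          · exact h3
        have hxa : x ≠ u i := by rintro rfl; simp [hx0] at h1
        have hxb : x ≠ u (i + 1) := by rintro rfl; simp [hx0] at h2
        exact (hcon x).2.2 (lt_of_le_of_ne hx.1 hxa.symm) (lt_of_le_of_ne hx.2 hxb) hx0
      have hlt := hu i h.1 h.2
      have := eval_pos_of_forall_ne_zero ordConnected_Icc hne (left_mem_Icc.2 hlt.le)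
        (right_mem_Icc.2 hlt.le) (by simpa using h1)
      rw [eval_mul, eval_C] at this
      rw [pow_succ] at h2
      linarith
    · exact ⟨0, fun h1 h2 => absurd ⟨h1, h2⟩ h⟩
  choose x hx using hroot
  have hmono : ∀ i k, a ≤ i → i < k → k < b → x i < x k := by
    intro i k hi hik hk
    induction k with
    | zero => omega
    | succ k ih =>
      have hstep : x k < x (k + 1) :=
        (hx k (by omega) (by omega)).2.1.trans (hx (k + 1) (by omega) hk).1
      rcases Nat.lt_succ_iff_lt_or_eq.1 hik with h | rfl
      · exact (ih h (by omega)).trans hstep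
      · exact hstep
  have humono : ∀ i k, a ≤ i → i ≤ k → k ≤ b → u i ≤ u k := by
    intro i k hi hik hk
    induction k, hik using Nat.le_induction with
    | base => exact le_rfl
    | succ k hik ih => exact (ih (by omega)).trans (hu k (by omega) hk).le
  obtain ⟨T, hT, hT'⟩ := exists_finset_derivative_roots (P := f) (c := 0)
    ((Finset.Ico a b).image x) fun y hy => by
      obtain ⟨i, hi, rfl⟩ := Finset.mem_image.1 hy
      obtain ⟨h1, h2⟩ := Finset.mem_Ico.1 hi
      exact (hx i h1 h2).2.2
  refine ⟨T, ?_, fun t ht => ?_⟩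
  · rwa [Finset.card_image_of_injOn, Nat.card_Ico] at hT
    intro i hi k hk hik
    obtain ⟨h1, h2⟩ := Finset.mem_Ico.1 (Finset.mem_coe.1 hi)
    obtain ⟨h3, h4⟩ := Finset.mem_Ico.1 (Finset.mem_coe.1 hk)
    by_contra hne
    rcases lt_or_gt_of_ne hne with h | h
    · exact absurd hik (hmono i k h1 h h4).ne
    · exact absurd hik (hmono k i h3 h h2).ne'
  · obtain ⟨h0, ⟨y, hy, hyt⟩, y', hy', hyt'⟩ := hT' t ht
    obtain ⟨i, hi, rfl⟩ := Finset.mem_image.1 hy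
    obtain ⟨k, hk, rfl⟩ := Finset.mem_image.1 hy'
    obtain ⟨h1, h2⟩ := Finset.mem_Ico.1 hi
    obtain ⟨h3, h4⟩ := Finset.mem_Ico.1 hk
    refine ⟨?_, ?_, h0⟩
    · exact ((humono a i le_rfl h1 h2.le).trans_lt (hx i h1 h2).1).trans hyt
    · exact hyt'.trans ((hx k h3 h4).2.1.trans_le (humono (k + 1) b (by omega) h4 le_rfl))

/-- The position of the corner in the alternation is determined by the signs of the error. -/
theorem Config.index_eq {n j j' : ℕ} {α β E F : ℝ} {p q : ℝ[X]} {z z' : ℕ → ℝ}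
    (h : Config n α E p j z) (h' : Config n β F q j' z') (hF : 0 < F)
    (hsign : ∀ i ≤ n + 1, i ≠ j → 0 < -(-1) ^ j * (-1) ^ i * (|z i - β| - q.eval (z i)))
    (hlo : z (j - 1) < β) (hhi : β < z (j + 1)) : j' = j := by
  have hj := h.pos
  have hjn := h.le
  have hβ : |β - β| - q.eval β = -F := by
    have := h'.osc.alt j' (by have := h'.le; omega)
    rw [h'.corner] at this
    rw [this, neg_mul, neg_one_pow_mul_self]; ring
  -- The old corner is replaced by the new one, where the error is `-F`, so the sequence of signs is
  -- preserved.
  set u : ℕ → ℝ := Function.update z j β with hu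
  have huj : u j = β := by simp [hu]
  have hui : ∀ i, i ≠ j → u i = z i := fun i hi => by simp [hu, hi]
  have hmono : ∀ i ≤ n, u i < u (i + 1) := by
    intro i hi
    by_cases h1 : i = j
    · subst h1
      rw [huj, hui _ (by omega)]; exact hhi
    · by_cases h2 : i + 1 = j
      · rw [h2, huj, hui _ h1]
        have : i = j - 1 := by omega
        rw [this]; exact hlo
      · rw [hui _ h1, hui _ h2]
        exact h.osc.mono (mem_Iic.2 (by omega)) (mem_Iic.2 (by omega)) i.lt_succ_self
  have husign : ∀ i ≤ n + 1, 0 < -(-1) ^ j * (-1) ^ i * (|u i - β| - q.eval (u i)) := by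
    intro i hi
    by_cases h1 : i = j
    · subst h1
      rw [huj, hβ, neg_mul, neg_one_pow_mul_self]; linarith
    · rw [hui i h1]; exact hsign i hi h1
  have humono : StrictMonoOn u (Iic (n + 1)) :=
    strictMonoOn_Iic_of_lt_succ fun i hi => hmono i (by omega)
  have hu0 : u 0 = -1 := by rw [hui 0 (by omega), h.zero]
  have hu1 : u (n + 1) = 1 := by rw [hui _ (by omega), h.last]
  obtain ⟨S, hS, hS'⟩ := exists_critical_of_alternation (f := C β - X - q) (a := 0) (b := j)
    (u := u) (σ := -(-1) ^ j) (fun i _ hi => hmono i (by omega)) fun i _ hi => by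
      have h1 := husign i (by omega)
      have h2 : u i ≤ β :=
        huj ▸ humono.monotoneOn (mem_Iic.2 (by omega)) (mem_Iic.2 (by omega)) hi
      rw [abs_of_nonpos (by linarith)] at h1
      simpa using h1
  obtain ⟨T, hT, hT'⟩ := exists_critical_of_alternation (f := X - C β - q) (a := j) (b := n + 1)
    (u := u) (σ := -(-1) ^ j) (fun i _ hi => hmono i (by omega)) fun i hi hi' => by
      have h1 := husign i hi'
      have h2 : β ≤ u i :=
        huj ▸ humono.monotoneOn (mem_Iic.2 (by omega)) (mem_Iic.2 hi') hi
      rw [abs_of_nonneg (by linarith)] at h1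
      simpa using h1
  -- At least `j - 1` critical points on the left give `j ≤ j'`; at least `n - j` on the right give
  -- `j' ≤ j`.
  have h1 := h'.left S fun x hx => by
    obtain ⟨h1, h2, h3⟩ := hS' x hx
    simp only [derivative_sub, derivative_C, derivative_X, eval_sub, eval_zero, eval_one] at h3
    exact ⟨hu0 ▸ h1, huj ▸ h2, by linarith⟩
  have h2 := h'.right T fun x hx => by
    obtain ⟨h1, h2, h3⟩ := hT' x hx
    simp only [derivative_sub, derivative_C, derivative_X, eval_sub, eval_zero, eval_one] at h3
    exact ⟨huj ▸ h1, hu1 ▸ h2, by linarith⟩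
  omega

theorem Config.alt_pos {n j : ℕ} {α E : ℝ} {p : ℝ[X]} {z : ℕ → ℝ} (h : Config n α E p j z)
    (hE : 0 < E) : ∀ i ≤ n + 1, 0 < -(-1) ^ j * (-1) ^ i * (|z i - α| - p.eval (z i)) := by
  intro i hi
  rw [h.osc.alt i hi]
  have e : -(-1 : ℝ) ^ j * (-1) ^ i * (-(-1) ^ j * (-1) ^ i * E) = E := by
    linear_combination (E * ((-1) ^ i * (-1) ^ i)) * neg_one_pow_mul_self j
      + E * neg_one_pow_mul_self i
  rw [e]; exact hE

theorem Config.lt_corner {n j : ℕ} {α E : ℝ} {p : ℝ[X]} {z : ℕ → ℝ} (h : Config n α E p j z) :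
    z (j - 1) < α ∧ α < z (j + 1) := by
  have hj := h.pos
  have hjn := h.le
  constructor
  · exact h.corner ▸ h.osc.mono (mem_Iic.2 (by omega)) (mem_Iic.2 (by omega)) (by omega)
  · exact h.corner ▸ h.osc.mono (mem_Iic.2 (by omega)) (mem_Iic.2 (by omega)) (by omega)

theorem Config.index_unique {n j j' : ℕ} {α E : ℝ} {p : ℝ[X]} {z z' : ℕ → ℝ}
    (h : Config n α E p j z) (h' : Config n α E p j' z') (hE : 0 < E) : j' = j :=
  h.index_eq h' hE (fun i hi _ => h.alt_pos hE i hi) h.lt_corner.1 h.lt_corner.2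

theorem neg_mem_Ioo {α : ℝ} (hα : α ∈ Ioo (-1 : ℝ) 1) : -α ∈ Ioo (-1 : ℝ) 1 :=
  ⟨by linarith [hα.2], by linarith [hα.1]⟩

/-- The reflected minimax polynomial, when the outer critical point lies to the left. -/
theorem exists_config_reflected {n : ℕ} (hn : 2 ≤ n) {α w : ℝ} {p : ℝ[X]}
    (hα : α ∈ Ioo (-1 : ℝ) 1) (hp : IsMinimax n α p) (hw : w < -1)
    (hd : p.derivative.eval w = -1) :
    ∃ j z, Config n (-α) (minimaxError n α) (p.comp (-X)) j z ∧ 2 ≤ j ∧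
      (∀ x ∈ Ioo 1 (-w), 0 < (-1) ^ (n + 1 + j) * ((p.comp (-X)).derivative.eval x - 1)) ∧
      0 < (-1) ^ j * p.coeff n := by
  obtain ⟨j, z, h1, h2, h3, h4⟩ := exists_config_of_outer_critical hn (neg_mem_Ioo hα)
    (isMinimax_comp_neg_X hp) (w := -w) (by linarith)
    (by rw [eval_derivative_comp_neg_X, neg_neg, hd, neg_neg])
  rw [minimaxError_neg] at h1
  refine ⟨j, z, h1, h2, h3, ?_⟩
  rw [coeff_comp_neg_X, pow_add] at h4
  linear_combination h4 + ((-1) ^ j * p.coeff n) * neg_one_pow_mul_self n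

/-- The two sides of the outer critical point give top coefficients of opposite signs relative to
the index, because reflection turns `j` into `n + 1 - j`. The index and this sign therefore tell the
side. -/
theorem exists_config {n : ℕ} (hn : 2 ≤ n) {α w : ℝ} (hα : α ∈ Ioo (-1 : ℝ) 1)
    (hw : IsOutsideCritical n α w) :
    ∃ j z, Config n α (minimaxError n α) (minimaxPoly n α) j z ∧
      (1 < w → 0 < (-1) ^ (n + j) * (minimaxPoly n α).coeff n) ∧
      (w < -1 → (-1) ^ (n + j) * (minimaxPoly n α).coeff n < 0) := by
  have hp := isMinimax_minimaxPoly n α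
  rcases lt_or_ge 1 w with h1 | h1
  · obtain ⟨j, z, h, -, -, h2⟩ := exists_config_of_outer_critical hn hα hp h1
      ((hasDerivAt_normalizedError_iff_of_gt hα h1).1 hw.2)
    exact ⟨j, z, h, fun _ => h2, fun h3 => by linarith⟩
  · have h2 : w < -1 := by
      by_contra hcon
      exact hw.1 ⟨not_lt.1 hcon, h1⟩
    obtain ⟨j, z, h, -, -, h3⟩ := exists_config_reflected hn hα hp h2
      ((hasDerivAt_normalizedError_iff_of_lt hα h2).1 hw.2)
    have hr := h.reflect
    rw [neg_neg, comp_neg_X_comp_neg_X] at hr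
    refine ⟨_, _, hr, fun h4 => by linarith, fun _ => ?_⟩
    have hj := h.le
    have e : n + (n + 1 - j) + j = 2 * n + 1 := by omega
    have e2 : (-1 : ℝ) ^ (n + (n + 1 - j)) * (-1) ^ j = -1 := by
      rw [← pow_add, e, pow_succ, pow_mul]; simp
    have e3 : (-1 : ℝ) ^ (n + (n + 1 - j)) = -(-1) ^ j := by
      linear_combination ((-1) ^ j) * e2
        - (-1) ^ (n + (n + 1 - j)) * neg_one_pow_mul_self j
    rw [e3]; linarith

theorem strictMonoOn_of_isOutsideCritical {n : ℕ} (hn : 2 ≤ n) {I : Set ℝ} (hI : I.OrdConnected)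
    (hsub : I ⊆ Ioo (-1 : ℝ) 1) {w : ℝ → ℝ} (hw : ∀ α ∈ I, IsOutsideCritical n α (w α)) :
    StrictMonoOn w I := by
  have hex : ∀ x : I, ∃ j z, Config n x (minimaxError n x) (minimaxPoly n x) j z ∧
      (1 < w x → 0 < (-1) ^ (n + j) * (minimaxPoly n x).coeff n) ∧
      (w x < -1 → (-1) ^ (n + j) * (minimaxPoly n x).coeff n < 0) :=
    fun x => exists_config hn (hsub x.2) (hw x x.2)
  choose J z hJ hJ1 hJ2 using hex
  have hside : ∀ x : I, 1 < w x ∨ w x < -1 := fun x => by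
    by_contra! hcon
    exact (hw x x.2).1 ⟨hcon.2, hcon.1⟩
  -- Strict signs of the error at the `z x i` and of the top coefficient persist for nearby corners.
  have hloc : IsLocallyConstant fun x : I => (J x, (1 < w x : Prop)) := by
    rw [IsLocallyConstant.iff_eventually_eq]
    intro x
    have hx := hsub x.2
    have hE := minimaxError_pos n hx
    have hlim := fun Λ => tendsto_minimaxPoly (by omega : 1 ≤ n) hx Λ
    have hc0 : (minimaxPoly n x).coeff n ≠ 0 := fun h0 => by
      rcases hside x with h | h
      · have := hJ1 x h; rw [h0, mul_zero] at this; exact lt_irrefl _ this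
      · have := hJ2 x h; rw [h0, mul_zero] at this; exact lt_irrefl _ this
    have hev1 : ∀ᶠ β in nhds (x : ℝ),
        0 < (minimaxPoly n x).coeff n * (minimaxPoly n β).coeff n := by
      have := (hlim (lcoeff ℝ n)).const_mul ((minimaxPoly n x).coeff n)
      simp only [lcoeff_apply] at this
      exact this.eventually (lt_mem_nhds (mul_self_pos.2 hc0))
    have hev2 : ∀ᶠ β in nhds (x : ℝ), ∀ i ∈ Finset.range (n + 2),
        0 < -(-1) ^ J x * (-1) ^ i * (|z x i - β| - (minimaxPoly n β).eval (z x i)) := by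
      rw [Filter.eventually_all_finset]
      intro i hi
      have h1 := hlim (leval (z x i))
      simp only [leval_apply] at h1
      have h2 : Filter.Tendsto (fun β : ℝ => |z x i - β|) (nhds (x : ℝ)) (nhds |z x i - x|) :=
        (by fun_prop : Continuous fun β : ℝ => |z x i - β|).tendsto _
      have h3 := (h2.sub h1).const_mul (-(-1) ^ J x * (-1) ^ i)
      exact h3.eventually (lt_mem_nhds ((hJ x).alt_pos hE i (by
        have := Finset.mem_range.1 hi
        omega)))
    have hev3 := Ioo_mem_nhds (hJ x).lt_corner.1 (hJ x).lt_corner.2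
    have hall := hev1.and (hev2.and hev3)
    filter_upwards [continuous_subtype_val.continuousAt.eventually hall] with β hβ
    obtain ⟨hb1, hb2, hb3⟩ := hβ
    have hjj : J β = J x := (hJ x).index_eq (hJ β) (minimaxError_pos n (hsub β.2))
      (fun i hi _ => hb2 i (Finset.mem_range.2 (by omega))) hb3.1 hb3.2
    refine Prod.ext hjj (propext ?_)
    have hsq := neg_one_pow_mul_self (n + J x)
    have key : 0 < ((-1) ^ (n + J x) * (minimaxPoly n x).coeff n)
        * ((-1) ^ (n + J x) * (minimaxPoly n β).coeff n) := by
      have e : ((-1) ^ (n + J x) * (minimaxPoly n x).coeff n)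
        * ((-1) ^ (n + J x) * (minimaxPoly n β).coeff n)
          = (minimaxPoly n x).coeff n * (minimaxPoly n β).coeff n := by
        linear_combination ((minimaxPoly n x).coeff n * (minimaxPoly n β).coeff n) * hsq
      rw [e]; exact hb1
    have hβ1 := hJ1 β
    have hβ2 := hJ2 β
    rw [hjj] at hβ1 hβ2
    constructor
    · intro h1
      refine (hside x).resolve_right fun h2 => ?_
      exact absurd key (not_lt.2 (mul_nonpos_of_nonpos_of_nonneg (hJ2 x h2).le (hβ1 h1).le))
    · intro h1
      refine (hside β).resolve_right fun h2 => ?_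
      exact absurd key (not_lt.2 (mul_nonpos_of_nonneg_of_nonpos (hJ1 x h1).le (hβ2 h2).le))
  have : PreconnectedSpace I := Subtype.preconnectedSpace hI.isPreconnected
  have hconst : ∀ x y : I, J x = J y ∧ (1 < w x ↔ 1 < w y) := fun x y => by
    have := hloc.apply_eq_of_preconnectedSpace x y
    exact ⟨congrArg Prod.fst this, iff_of_eq (congrArg Prod.snd this)⟩
  intro α hα β hβ hαβ
  obtain ⟨hJJ, hss⟩ := hconst ⟨α, hα⟩ ⟨β, hβ⟩
  have hα' := hsub hα
  have hβ' := hsub hβ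
  have hEα := minimaxError_pos n hα'
  have hEβ := minimaxError_pos n hβ'
  have hpα := isMinimax_minimaxPoly n α
  have hpβ := isMinimax_minimaxPoly n β
  rcases hside ⟨α, hα⟩ with h1 | h1
  · have h2 : 1 < w β := hss.1 h1
    have hdα := (hasDerivAt_normalizedError_iff_of_gt hα' h1).1 (hw α hα).2
    have hdβ := (hasDerivAt_normalizedError_iff_of_gt hβ' h2).1 (hw β hβ).2
    obtain ⟨j, y, hc, hj, hs, -⟩ := exists_config_of_outer_critical hn hα' hpα h1 hdα
    obtain ⟨k, y', hc', -, -, -⟩ := exists_config_of_outer_critical hn hβ' hpβ h2 hdβ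
    have e1 : j = J ⟨α, hα⟩ := (hJ ⟨α, hα⟩).index_unique hc hEα
    have e2 : k = J ⟨β, hβ⟩ := (hJ ⟨β, hβ⟩).index_unique hc' hEβ
    obtain rfl : k = j := by rw [e1, e2, hJJ]
    exact outer_critical_lt hn hαβ hEα hEβ hpα.1 hpβ.1 hc hc' hj hdα hs h2 hdβ
  · have h2 : w β < -1 := (hside ⟨β, hβ⟩).resolve_left fun h2 => by
      have : 1 < w α := hss.2 h2
      have : w α < -1 := h1
      linarith
    have hdα := (hasDerivAt_normalizedError_iff_of_lt hα' h1).1 (hw α hα).2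
    have hdβ := (hasDerivAt_normalizedError_iff_of_lt hβ' h2).1 (hw β hβ).2
    obtain ⟨j, y, hc, -, -, -⟩ := exists_config_reflected hn hα' hpα h1 hdα
    obtain ⟨k, y', hc', hk, hs, -⟩ := exists_config_reflected hn hβ' hpβ h2 hdβ
    have hr := hc.reflect
    have hr' := hc'.reflect
    rw [neg_neg, comp_neg_X_comp_neg_X] at hr hr'
    have e1 : n + 1 - j = J ⟨α, hα⟩ := (hJ ⟨α, hα⟩).index_unique hr hEα
    have e2 : n + 1 - k = J ⟨β, hβ⟩ := (hJ ⟨β, hβ⟩).index_unique hr' hEβ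
    obtain rfl : k = j := by
      have := hc.le
      have := hc'.le
      omega
    have h1' : w α < -1 := h1
    -- Reflection reverses the order of the corners, so `β` and `α` exchange roles.
    have := outer_critical_lt hn (neg_lt_neg hαβ) hEβ hEα
      ((natDegree_comp_neg_X _).trans_le hpβ.1) ((natDegree_comp_neg_X _).trans_le hpα.1) hc' hc hk
      (v := -w β) (w := -w α) (by rw [eval_derivative_comp_neg_X, neg_neg, hdβ, neg_neg]) hs
      (by linarith) (by rw [eval_derivative_comp_neg_X, neg_neg, hdα, neg_neg])
    linarith

end Checkmark

theorem mainTheorem5 (n : ℕ) (hn : 2 ≤ n) :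
    (∀ α ∈ Set.Ioo (-1 : ℝ) 1, {-1, 1} ⊆ alternationSet n α →
      ¬ IsVShapeTip (n - 1) α → ¬ InVShape n α → ∃ w : ℝ, IsOutsideCritical n α w) ∧
    (∀ I : Set ℝ, I.OrdConnected → I ⊆ Set.Ioo (-1 : ℝ) 1 →
      ∀ w : ℝ → ℝ, (∀ α ∈ I, IsOutsideCritical n α (w α)) → StrictMonoOn w I) :=
  ⟨fun _ hα hA htip hV => Checkmark.exists_isOutsideCritical hn hα hA htip hV,
    fun _ hI hsub _ hw => Checkmark.strictMonoOn_of_isOutsideCritical hn hI hsub hw⟩
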